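/- A quantitative automaton is a tuple $\mathcal A=(\Sigma,Q,\iota,\delta)$ with a finite alphabet $\Sigma$, a finite nonempty set $Q$ of states, an initial state $\iota\in Q$, and a transition function $\delta$ that maps every $(q,\sigma)\in Q\times\Sigma$ to a finite nonempty set of pairs $(x,q')\in\mathbb Q\times Q$ of a weight and a successor state; it is deterministic if every $\delta(q,\sigma)$ is a singleton. For $\mathrm{Val}\in\{\mathrm{LimInf},\mathrm{LimSup}\}$, where $\mathrm{LimInf}(x)=\lim_{m\to\infty}\inf_{i\ge m}x_i$ and $\mathrm{LimSup}(x)=\lim_{m\to\infty}\sup_{i\ge m}x_i$, the value $\mathcal A(w)$ of a $\mathrm{Val}$-automaton on an infinite word $w\in\Sigma^\omega$ is the supremum, over all runs of $\mathcal A$ on $w$ from $\iota$, of $\mathrm{Val}$ of the sequence of weights of the run. The size of $\mathcal A$ is the maximum of the sizes of its alphabet, its state space and its transition space, with weights written in binary. A function $\Phi$ from $\Sigma^\omega$ to the extended reals is safe if for every $w\in\Sigma^\omega$ and every value $v$ with $\Phi(w)\not\ge v$ there is a finite prefix $u$ of $w$ with $\sup_{w'\in\Sigma^\omega}\Phi(uw')\not\ge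 v$. It is live if for every $w\in\Sigma^\omega$ with $\Phi(w)<\sup_{w'\in\Sigma^\omega}\Phi(w')$ there is a value $v$ with $\Phi(w)\not\ge v$ such that $\sup_{w'\in\Sigma^\omega}\Phi(uw')\ge v$ for all finite prefixes $u$ of $w$. An automaton is safe (live) if the function $w\mapsto\mathcal A(w)$ is. **Theorem.** Let $\mathrm{Val}\in\{\mathrm{LimInf},\mathrm{LimSup}\}$. There is an algorithm that, given a deterministic $\mathrm{Val}$-automaton $\mathcal A$, constructs in time polynomial in the size of $\mathcal A$ a deterministic safe $\mathrm{Val}$-automaton $\mathcal B$ and a deterministic live $\mathrm{Val}$-automaton $\mathcal C$, over the same alphabet, such that $\mathcal A(w)=\min(\mathcal B(w),\mathcal C(w))$ for every infinite word $w$. -/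

import Mathlib

namespace QAut

/-! ## Infinite words and quantitative properties -/

/-- Infinite words over the alphabet `Λ`. -/
abbrev Word (Λ : Type) : Type := ℕ → Λ

/-- `extend w n w'` is the infinite word `u w'`, where `u` is the prefix of `w` of length `n`. -/
def extend {Λ : Type} (w : Word Λ) (n : ℕ) (w' : Word Λ) : Word Λ :=
  fun i => if i < n then w i else w' (i - n)

/-- The top value `sup_w Φ(w)` of a property. -/
def topValue {Λ D : Type} [CompleteLattice D] (Φ : Word Λ → D) : D := ⨆ w, Φ w

/-- Quantitative safety: every wrong hypothesis `Φ(w) ≥ v` has a finite prefix `u` of `w` that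
witnesses the violation, that is, `sup_{w'} Φ(u w') ≱ v`. -/
def IsSafe {Λ D : Type} [CompleteLattice D] (Φ : Word Λ → D) : Prop :=
  ∀ (w : Word Λ) (v : D), ¬ v ≤ Φ w → ∃ n : ℕ, ¬ v ≤ ⨆ w' : Word Λ, Φ (extend w n w')

/-- Quantitative liveness: every word whose value is below the top value of the property has a
wrong hypothesis `Φ(w) ≥ v` that no finite prefix refutes. -/
def IsLive {Λ D : Type} [CompleteLattice D] (Φ : Word Λ → D) : Prop :=
  ∀ w : Word Λ, Φ w < topValue Φ →
    ∃ v : D, ¬ v ≤ Φ w ∧ ∀ n : ℕ, v ≤ ⨆ w' : Word Λ, Φ (extend w n w')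

/-! ## Value functions -/

/-- The value function `LimInf` on sequences of rational weights. -/
noncomputable def limInfVal (x : ℕ → ℚ) : ℝ :=
  Filter.liminf (fun i => (x i : ℝ)) Filter.atTop

/-- The value function `LimSup` on sequences of rational weights. -/
noncomputable def limSupVal (x : ℕ → ℚ) : ℝ :=
  Filter.limsup (fun i => (x i : ℝ)) Filter.atTop

/-! ## Quantitative automata -/

/-- A (total, nondeterministic) quantitative automaton with alphabet `Λ` and state space `Q`: an
initial state, and for every state and letter a nonempty finite set of weight-state pairs. -/
structure QAutomaton (Λ Q : Type) where
  init : Q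
  δ : Q → Λ → Finset (ℚ × Q)
  total : ∀ q a, (δ q a).Nonempty

namespace QAutomaton

variable {Λ Q : Type}

/-- `A` is deterministic if every `δ q a` is a singleton. -/
def IsDeterministic (A : QAutomaton Λ Q) : Prop := ∀ q a, ∃ t, A.δ q a = {t}

/-- `q 0 --w 0 : x 0--> q 1 --w 1 : x 1--> q 2 ...` is a run of `A` on the word `w`. -/
def IsRun (A : QAutomaton Λ Q) (w : Word Λ) (q : ℕ → Q) (x : ℕ → ℚ) : Prop :=
  q 0 = A.init ∧ ∀ i, (x i, q (i + 1)) ∈ A.δ (q i) (w i)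

/-- The property expressed by the `Val`-automaton `A`: the value of a word is the supremum of the
values of all runs on it. -/
noncomputable def value (Val : (ℕ → ℚ) → ℝ) (A : QAutomaton Λ Q) (w : Word Λ) : EReal :=
  ⨆ (q : ℕ → Q) (x : ℕ → ℚ) (_ : A.IsRun w q x), (Val x : EReal)

end QAutomaton

/-- The number of binary digits used to write a rational number. -/
def ratBits (x : ℚ) : ℕ := Nat.size x.num.natAbs + Nat.size x.den

/-- The size of an automaton: the maximum of the size of the alphabet, the size of the state space,
and the size of the transition space, where weights are written in binary. -/
def QAutomaton.size {k n : ℕ} (A : QAutomaton (Fin k) (Fin n)) : ℕ :=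
  max k (max n (∑ q, ∑ a, ∑ t ∈ A.δ q a, (1 + ratBits t.1)))

/-! ## A machine model with a running time

Structured WHILE programs whose variables hold finite binary trees. Every step is charged the size
of all the trees that it evaluates, so that the running time agrees, up to a polynomial, with that
of a multitape Turing machine. -/

/-- Finite binary trees, the data of the machine. -/
inductive Data : Type
  | nil : Data
  | cons : Data → Data → Data

namespace Data

def size : Data → ℕ
  | nil => 1
  | cons a b => 1 + a.size + b.size

def hd : Data → Data
  | nil => nil
  | cons a _ => a

def tl : Data → Data
  | nil => nil
  | cons _ b => b

/-- The list `d₁, …, dₘ` as the tree `cons d₁ (… (cons dₘ nil))`. -/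
def ofList : List Data → Data
  | [] => nil
  | d :: l => cons d (ofList l)

/-- Unary notation, used for the names of states. -/
def ofUnary (m : ℕ) : Data := ofList (List.replicate m nil)

def ofBool (b : Bool) : Data := if b then cons nil nil else nil

/-- Binary notation, least significant digit first. -/
def ofBinary (m : ℕ) : Data := ofList (m.bits.map ofBool)

/-- A rational number as its sign, its numerator and its denominator (in lowest terms), the last
two in binary. -/
def ofRat (x : ℚ) : Data :=
  cons (ofBool (decide (x < 0))) (cons (ofBinary x.num.natAbs) (ofBinary x.den))

end Data

/-- Stores: the contents of the variables `0, 1, 2, …`. -/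
abbrev Store : Type := ℕ → Data

/-- Expressions. -/
inductive Expr : Type
  | var : ℕ → Expr
  | nil : Expr
  | cons : Expr → Expr → Expr
  | hd : Expr → Expr
  | tl : Expr → Expr

namespace Expr

def eval (s : Store) : Expr → Data
  | var i => s i
  | nil => Data.nil
  | cons e f => Data.cons (e.eval s) (f.eval s)
  | hd e => (e.eval s).hd
  | tl e => (e.eval s).tl

/-- The cost of evaluating an expression: the total size of the values of its subexpressions. -/
def cost (s : Store) : Expr → ℕ
  | var i => (s i).size
  | nil => 1
  | cons e f => e.cost s + f.cost s + ((cons e f).eval s).size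
  | hd e => e.cost s + ((hd e).eval s).size
  | tl e => e.cost s + ((tl e).eval s).size

end Expr

/-- Programs. A test succeeds when its expression does not evaluate to `nil`. -/
inductive Program : Type
  | assign : ℕ → Expr → Program
  | seq : Program → Program → Program
  | ite : Expr → Program → Program → Program
  | loop : Expr → Program → Program

/-- `Exec p s t s'`: started in the store `s`, the program `p` halts in the store `s'` after time
exactly `t`. -/
inductive Exec : Program → Store → ℕ → Store → Prop
  | assign (i : ℕ) (e : Expr) (s : Store) :
      Exec (.assign i e) s (1 + e.cost s) (Function.update s i (e.eval s))
  | seq {p q : Program} {s s' s'' : Store} {t t' : ℕ} :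
      Exec p s t s' → Exec q s' t' s'' → Exec (.seq p q) s (t + t') s''
  | ite_true {e : Expr} {p q : Program} {s s' : Store} {t : ℕ} :
      e.eval s ≠ Data.nil → Exec p s t s' → Exec (.ite e p q) s (1 + e.cost s + t) s'
  | ite_false {e : Expr} {p q : Program} {s s' : Store} {t : ℕ} :
      e.eval s = Data.nil → Exec q s t s' → Exec (.ite e p q) s (1 + e.cost s + t) s'
  | loop_true {e : Expr} {p : Program} {s s' s'' : Store} {t t' : ℕ} :
      e.eval s ≠ Data.nil → Exec p s t s' → Exec (.loop e p) s' t' s'' →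
        Exec (.loop e p) s (1 + e.cost s + t + t') s''
  | loop_false {e : Expr} {p : Program} {s : Store} :
      e.eval s = Data.nil → Exec (.loop e p) s (1 + e.cost s) s

/-- The initial store: the input is in variable `0`, all other variables are empty. -/
def Store.initial (d : Data) : Store := fun i => if i = 0 then d else Data.nil

/-- On input `d` the program `p` halts within time `T`, with output `d'` in variable `0`. -/
def Program.OutputsInTime (p : Program) (d d' : Data) (T : ℕ) : Prop :=
  ∃ (t : ℕ) (s : Store), t ≤ T ∧ Exec p (Store.initial d) t s ∧ s 0 = d'

/-- An automaton as an input or output of a program: the initial state, and the table of `δ` with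
one row for each state and one entry for each letter in it, which lists the transitions (in some
order, which is immaterial for a deterministic automaton). -/
noncomputable def QAutomaton.encode {k n : ℕ} (A : QAutomaton (Fin k) (Fin n)) : Data :=
  .cons (.ofUnary A.init)
    (.ofList (List.ofFn fun q : Fin n =>
      .ofList (List.ofFn fun a : Fin k =>
        .ofList ((A.δ q a).toList.map fun t => .cons (.ofRat t.1) (.ofUnary t.2)))))

end QAut

/-! For a state `q` let T(q) be the largest value of a word read from `q`. Both limits ignore finite
prefixes, so T never increases along a run, and since there are finitely many states it becomes
constant, say equal to t.

The safe part keeps the states and gives every transition the weight T of its target. Its value on a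
word is t, the limit of the best values still achievable; this is safe, because a prefix after which
T has stabilised refutes every larger hypothesis. The live part keeps a weight that is smaller than
T of the target and raises every other weight to T of the initial state. If the original value x of
a word satisfies x < t, the live value is still x; if x = t, it is T of the initial state, which is
the top value. In both cases the minimum of the two parts is x (`IsBest.value_eq_min`). The live
part is live because every prefix can be continued by a best word of the state reached, whose value
then equals the eventual t and is raised to the top (`IsBest.isVal_live`, `IsBest.isLive`).

T(q) is computed on the transition graph: it is the largest weight of an edge reachable from `q`
that lies on a cycle, where for LimInf no edge of the cycle may weigh less than that edge.
Pigeonhole on a run gives one inequality (`mem_cycleWeights_of_isVal`), pumping a cycle gives the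
other (`exists_isVal_of_mem_cycleWeights`).

For the running time, the functions computed by polynomial-time programs are shown to be closed
under composition, pairing, branching and folds with controlled growth (`PolyTime.foldl_of_size`,
`PolyTime.foldl`). List operations, binary arithmetic, comparison of rationals, reachability and the
whole construction are then assembled from these (`PolyTime.decompose`). -/

namespace QAut

/-! ## Polynomial-time computable functions -/

/-- Types whose elements are represented by trees. -/
class Enc (α : Type) where
  enc : α → Data

open Enc

variable {α β γ κ : Type} [Enc α] [Enc β] [Enc γ] [Enc κ]

/-- The size of the representation. -/
def sz (a : α) : ℕ := (enc a).size

lemma Data.size_pos (d : Data) : 1 ≤ d.size := by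
  cases d <;> simp [Data.size]; omega

lemma Data.size_hd_le (d : Data) : d.hd.size ≤ d.size := by
  cases d <;> simp [Data.size, Data.hd]; omega

lemma Data.size_tl_le (d : Data) : d.tl.size ≤ d.size := by
  cases d <;> simp [Data.size, Data.tl]

lemma eval_mono (P : Polynomial ℕ) {m n : ℕ} (h : m ≤ n) : P.eval m ≤ P.eval n := by
  rw [Polynomial.eval_eq_sum_range, Polynomial.eval_eq_sum_range]
  gcongr

/-- `g` is bounded by a polynomial in the size of its argument. -/
def PolyBdd (g : α → ℕ) : Prop := ∃ P : Polynomial ℕ, ∀ a, g a ≤ P.eval (sz a)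

namespace PolyBdd

lemma const (c : ℕ) : PolyBdd (fun _ : α => c) := ⟨Polynomial.C c, by simp⟩

lemma self : PolyBdd (fun a : α => sz a) := ⟨Polynomial.X, by simp⟩

lemma add {g h : α → ℕ} (hg : PolyBdd g) (hh : PolyBdd h) : PolyBdd (fun a => g a + h a) := by
  obtain ⟨P, hP⟩ := hg
  obtain ⟨R, hR⟩ := hh
  exact ⟨P + R, fun a => by simpa using Nat.add_le_add (hP a) (hR a)⟩

lemma mul {g h : α → ℕ} (hg : PolyBdd g) (hh : PolyBdd h) : PolyBdd (fun a => g a * h a) := by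
  obtain ⟨P, hP⟩ := hg
  obtain ⟨R, hR⟩ := hh
  exact ⟨P * R, fun a => by simpa using Nat.mul_le_mul (hP a) (hR a)⟩

lemma mono {g h : α → ℕ} (hh : PolyBdd h) (hgh : ∀ a, g a ≤ h a) : PolyBdd g := by
  obtain ⟨R, hR⟩ := hh
  exact ⟨R, fun a => (hgh a).trans (hR a)⟩

lemma comp {g : β → ℕ} {f : α → β} (hg : PolyBdd g) (hf : PolyBdd (fun a => sz (f a))) :
    PolyBdd (fun a => g (f a)) := by
  obtain ⟨P, hP⟩ := hg
  obtain ⟨R, hR⟩ := hf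
  refine ⟨P.comp R, fun a => (hP _).trans ?_⟩
  rw [Polynomial.eval_comp]
  exact eval_mono P (hR a)

/-- A monotone uniform version of polynomial boundedness. -/
lemma exists_monotone {g : α → ℕ} (hg : PolyBdd g) :
    ∃ G : ℕ → ℕ, Monotone G ∧ (∀ a, g a ≤ G (sz a)) ∧
      ∀ {κ : Type} [Enc κ] (h : κ → ℕ), PolyBdd h → PolyBdd (fun c => G (h c)) := by
  obtain ⟨P, hP⟩ := hg
  refine ⟨fun n => P.eval n, fun _ _ h => eval_mono P h, hP, ?_⟩
  rintro κ _ h ⟨R, hR⟩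
  refine ⟨P.comp R, fun a => ?_⟩
  rw [Polynomial.eval_comp]
  exact eval_mono P (hR a)

end PolyBdd

/-- `p` computes `f` on trees that represent elements of `α`, in time at most `T`, and changes only
variables with numbers up to `N`. -/
def Program.Computes (p : Program) (N : ℕ) (f : α → β) (T : α → ℕ) : Prop :=
  ∀ (a : α) (s : Store), s 0 = enc a → ∃ (t : ℕ) (s' : Store), Exec p s t s' ∧ t ≤ T a ∧
    s' 0 = enc (f a) ∧ ∀ i, N < i → s' i = s i

/-- `f` is computable in polynomial time (with an output of polynomial size). -/
def PolyTime (f : α → β) : Prop :=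
  ∃ (p : Program) (N : ℕ) (T : α → ℕ), PolyBdd T ∧ p.Computes N f T ∧ PolyBdd (fun a => sz (f a))

lemma Program.Computes.mono {p : Program} {N M : ℕ} {f : α → β} {T : α → ℕ}
    (h : p.Computes N f T) (hNM : N ≤ M) : p.Computes M f T := by
  intro a s hs
  obtain ⟨t, s', h1, h2, h3, h4⟩ := h a s hs
  exact ⟨t, s', h1, h2, h3, fun i hi => h4 i (by omega)⟩

/-! ### Basic programs: expressions, composition, pairing, branching. -/

namespace PolyTime

lemma size {f : α → β} (hf : PolyTime f) : PolyBdd (fun a => sz (f a)) := hf.choose_spec.choose_spec.choose_spec.2.2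

lemma of_expr {f : α → β} (e : Expr) {C : α → ℕ}
    (he : ∀ (a : α) (s : Store), s 0 = enc a → e.eval s = enc (f a) ∧ e.cost s ≤ C a)
    (hC : PolyBdd C) (hf : PolyBdd (fun a => sz (f a))) : PolyTime f := by
  refine ⟨.assign 0 e, 0, fun a => 1 + C a, (PolyBdd.const 1).add hC, ?_, hf⟩
  intro a s hs
  refine ⟨_, _, Exec.assign 0 e s, ?_, ?_, ?_⟩
  · have := (he a s hs).2
    dsimp only
    omega
  · simp [(he a s hs).1]
  · intro i hi
    simp [Function.update_of_ne (by omega : i ≠ 0)]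

/-- Many functions between encoded types act on trees as the identity or as a projection; this lemma
and the next two make all of them computable at once. -/
lemma of_enc_eq {f : α → β} (h : ∀ a, enc (f a) = enc a) : PolyTime f :=
  of_expr (.var 0) (C := fun a => sz a) (fun a s hs => by simp [Expr.eval, Expr.cost, hs, h, sz])
    .self (by simpa [sz, h] using (PolyBdd.self (α := α)))

lemma of_enc_eq_hd {f : α → β} (h : ∀ a, enc (f a) = (enc a).hd) : PolyTime f :=
  of_expr (.hd (.var 0)) (C := fun a => sz a + sz a)
    (fun a s hs => by simp [Expr.eval, Expr.cost, hs, h, sz, Data.size_hd_le]) (.add .self .self)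
    (PolyBdd.self.mono fun a => by simp [sz, h, Data.size_hd_le])

lemma of_enc_eq_tl {f : α → β} (h : ∀ a, enc (f a) = (enc a).tl) : PolyTime f :=
  of_expr (.tl (.var 0)) (C := fun a => sz a + sz a)
    (fun a s hs => by simp [Expr.eval, Expr.cost, hs, h, sz, Data.size_tl_le]) (.add .self .self)
    (PolyBdd.self.mono fun a => by simp [sz, h, Data.size_tl_le])

/-- A closed expression with a given value. -/
def constExpr : Data → Expr
  | .nil => .nil
  | .cons a b => .cons (constExpr a) (constExpr b)

lemma eval_constExpr (s : Store) (d : Data) : (constExpr d).eval s = d := by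
  induction d with
  | nil => rfl
  | cons a b iha ihb => simp [constExpr, Expr.eval, iha, ihb]

lemma cost_constExpr (s s' : Store) (d : Data) : (constExpr d).cost s = (constExpr d).cost s' := by
  induction d with
  | nil => rfl
  | cons a b iha ihb => simp [constExpr, Expr.cost, Expr.eval, iha, ihb, eval_constExpr]

lemma const (b : β) : PolyTime (fun _ : α => b) :=
  of_expr (constExpr (enc b)) (C := fun _ => (constExpr (enc b)).cost fun _ => .nil)
    (fun _ _ _ => ⟨eval_constExpr _ _, (cost_constExpr _ _ _).le⟩) (.const _) (.const _)

/-- The second program is charged in terms of the size of `f a`; this is why `PolyTime` includes a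
bound on the size of the output. -/
lemma comp {g : β → γ} {f : α → β} (hg : PolyTime g) (hf : PolyTime f) :
    PolyTime (fun a => g (f a)) := by
  obtain ⟨q, M, U, hU, hq, hgs⟩ := hg
  obtain ⟨p, N, T, hT, hp, hfs⟩ := hf
  refine ⟨.seq p q, max N M, fun a => T a + U (f a), hT.add (hU.comp hfs), ?_, hgs.comp hfs⟩
  intro a s hs
  obtain ⟨t, s', h1, h2, h3, h4⟩ := hp.mono (le_max_left N M) a s hs
  obtain ⟨u, s'', k1, k2, k3, k4⟩ := hq.mono (le_max_right N M) (f a) s' h3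
  exact ⟨_, _, .seq h1 k1, Nat.add_le_add h2 k2, k3, fun i hi => (k4 i hi).trans (h4 i hi)⟩

/-- The input and the first result are parked in the variables `N + 1` and `N + 2`, which neither
program touches. -/
lemma of_enc_eq_cons {f : α → κ} {g : α → β} {h : α → γ} (hg : PolyTime g) (hh : PolyTime h)
    (hf : ∀ a, enc (f a) = .cons (enc (g a)) (enc (h a))) : PolyTime f := by
  obtain ⟨p, N₁, T, hT, hp, hgs⟩ := hg
  obtain ⟨q, N₂, U, hU, hq, hhs⟩ := hh
  set N := max N₁ N₂
  have hp := hp.mono (le_max_left N₁ N₂)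
  have hq := hq.mono (le_max_right N₁ N₂)
  refine ⟨.seq (.assign (N + 1) (.var 0)) (.seq p (.seq (.assign (N + 2) (.var 0))
      (.seq (.assign 0 (.var (N + 1))) (.seq q (.assign 0 (.cons (.var (N + 2)) (.var 0))))))),
    N + 2, fun a => (1 + sz a) + (T a + ((1 + sz (g a)) + ((1 + sz a) + (U a +
      (1 + (sz (g a) + sz (h a) + (1 + sz (g a) + sz (h a)))))))), ?_, ?_, ?_⟩
  · have c := PolyBdd.const (α := α) 1
    have i := PolyBdd.self (α := α)
    exact (c.add i).add (hT.add ((c.add hgs).add ((c.add i).add (hU.add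
      (c.add ((hgs.add hhs).add ((c.add hgs).add hhs)))))))
  · intro a s hs
    obtain ⟨t, s₁, h1, h2, h3, h4⟩ := hp a (Function.update s (N + 1) (s 0)) (by simp [hs])
    have e1 : s₁ (N + 1) = enc a := by rw [h4 _ (by omega)]; simp [hs]
    obtain ⟨u, s₂, k1, k2, k3, k4⟩ := hq a
      (Function.update (Function.update s₁ (N + 2) (s₁ 0)) 0 (s₁ (N + 1))) (by simp [e1])
    have e2 : s₂ (N + 2) = enc (g a) := by rw [k4 _ (by omega)]; simp [h3]
    have x1 := Exec.assign (N + 1) (.var 0) s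
    have x2 := Exec.assign (N + 2) (.var 0) s₁
    have x3 := Exec.assign 0 (.var (N + 1)) (Function.update s₁ (N + 2) (s₁ 0))
    have x4 := Exec.assign 0 (.cons (.var (N + 2)) (.var 0)) s₂
    simp only [Expr.eval] at x1 x2 x3
    rw [Function.update_of_ne (by omega : N + 1 ≠ N + 2)] at x3
    refine ⟨_, _, .seq x1 (.seq h1 (.seq x2 (.seq x3 (.seq k1 x4)))), ?_, ?_, ?_⟩
    · simp only [Expr.cost, Expr.eval, Data.size, hs, h3, e2, k3,
        Function.update_of_ne (by omega : N + 1 ≠ N + 2), e1, sz]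
      omega
    · simp [Expr.eval, e2, k3, hf]
    · intro i hi
      rw [Function.update_of_ne (by omega), k4 i (by omega), Function.update_of_ne (by omega),
        Function.update_of_ne (by omega), h4 i (by omega), Function.update_of_ne (by omega)]
  · refine (((PolyBdd.const 1).add hgs).add hhs).mono fun a => ?_
    simp [sz, hf, Data.size]

/-- The machine can only test a tree for being `nil`, so the case distinction is stated on the
encoding of `c a`; `κ` need not be `Bool`. -/
lemma of_branch {c : α → κ} {f g h : α → β} (hc : PolyTime c) (hf : PolyTime f) (hg : PolyTime g)
    (h1 : ∀ a, enc (c a) ≠ .nil → h a = f a) (h0 : ∀ a, enc (c a) = .nil → h a = g a) :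
    PolyTime h := by
  obtain ⟨r, N₀, R, hR, hr, hcs⟩ := hc
  obtain ⟨p, N₁, T, hT, hp, hfs⟩ := hf
  obtain ⟨q, N₂, U, hU, hq, hgs⟩ := hg
  set N := max N₀ (max N₁ N₂)
  have hr := hr.mono (le_max_left N₀ (max N₁ N₂))
  have hp := hp.mono ((le_max_left N₁ N₂).trans (le_max_right N₀ _))
  have hq := hq.mono ((le_max_right N₁ N₂).trans (le_max_right N₀ _))
  refine ⟨.seq (.assign (N + 1) (.var 0)) (.seq r (.seq (.assign (N + 2) (.var 0))
      (.seq (.assign 0 (.var (N + 1))) (.ite (.var (N + 2)) p q)))),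
    N + 2, fun a => (1 + sz a) + (R a + ((1 + sz (c a)) + ((1 + sz a) + (1 + sz (c a) +
      (T a + U a))))), ?_, ?_, ?_⟩
  · have k := PolyBdd.const (α := α) 1
    have i := PolyBdd.self (α := α)
    exact (k.add i).add (hR.add ((k.add hcs).add ((k.add i).add ((k.add hcs).add (hT.add hU)))))
  · intro a s hs
    obtain ⟨t, s₁, r1, r2, r3, r4⟩ := hr a (Function.update s (N + 1) (s 0)) (by simp [hs])
    have e1 : s₁ (N + 1) = enc a := by rw [r4 _ (by omega)]; simp [hs]
    obtain ⟨s₂, hs₂⟩ : ∃ s₂, s₂ = Function.update (Function.update s₁ (N + 2) (s₁ 0)) 0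
      (s₁ (N + 1)) := ⟨_, rfl⟩
    have e2 : s₂ 0 = enc a := by simp [hs₂, e1]
    have e3 : s₂ (N + 2) = enc (c a) := by simp [hs₂, r3]
    have e4 : ∀ i, N + 2 < i → s₂ i = s i := fun i hi => by
      rw [hs₂, Function.update_of_ne (by omega), Function.update_of_ne (by omega),
        r4 i (by omega), Function.update_of_ne (by omega)]
    have x1 := Exec.assign (N + 1) (.var 0) s
    have x2 := Exec.assign (N + 2) (.var 0) s₁
    have x3 := Exec.assign 0 (.var (N + 1)) (Function.update s₁ (N + 2) (s₁ 0))
    simp only [Expr.eval] at x1 x2 x3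
    rw [Function.update_of_ne (by omega : N + 1 ≠ N + 2), ← hs₂] at x3
    by_cases hc : enc (c a) = .nil
    · obtain ⟨u, s₃, k1, k2, k3, k4⟩ := hq a s₂ e2
      refine ⟨_, _, .seq x1 (.seq r1 (.seq x2 (.seq x3 (.ite_false (by simp [Expr.eval, e3, hc]) k1)))), ?_, ?_, ?_⟩
      · simp only [Expr.cost, hs, r3, e3, Function.update_of_ne (by omega : N + 1 ≠ N + 2), e1, sz]
        omega
      · rw [k3, h0 a hc]
      · exact fun i hi => (k4 i (by omega)).trans (e4 i hi)
    · obtain ⟨u, s₃, k1, k2, k3, k4⟩ := hp a s₂ e2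
      refine ⟨_, _, .seq x1 (.seq r1 (.seq x2 (.seq x3 (.ite_true (by simpa [Expr.eval, e3] using hc) k1)))), ?_, ?_, ?_⟩
      · simp only [Expr.cost, hs, r3, e3, Function.update_of_ne (by omega : N + 1 ≠ N + 2), e1, sz]
        omega
      · rw [k3, h1 a hc]
      · exact fun i hi => (k4 i (by omega)).trans (e4 i hi)
  · refine (hfs.add hgs).mono fun a => ?_
    by_cases hc : enc (c a) = .nil
    · rw [h0 a hc]; omega
    · rw [h1 a hc]; omega

end PolyTime

/-! ## Representations of the basic types -/

instance : Enc Data := ⟨id⟩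
instance : Enc Bool := ⟨Data.ofBool⟩
instance : Enc (α × β) := ⟨fun x => .cons (enc x.1) (enc x.2)⟩
instance : Enc (List α) := ⟨fun l => .ofList (l.map enc)⟩
instance : Enc ℕ := ⟨Data.ofUnary⟩
instance : Enc ℚ := ⟨Data.ofRat⟩

lemma enc_pair (a : α) (b : β) : enc (a, b) = .cons (enc a) (enc b) := rfl
lemma enc_nil : enc ([] : List α) = .nil := rfl
lemma enc_cons (a : α) (l : List α) : enc (a :: l) = .cons (enc a) (enc l) := rfl
lemma sz_pair (a : α) (b : β) : sz (a, b) = 1 + sz a + sz b := rfl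
lemma sz_nil : sz ([] : List α) = 1 := rfl
lemma sz_cons (a : α) (l : List α) : sz (a :: l) = 1 + sz a + sz l := rfl
lemma sz_pos (a : α) : 1 ≤ sz a := Data.size_pos _

lemma sz_le_of_mem {l : List α} {a : α} (h : a ∈ l) : sz a ≤ sz l := by
  induction l with
  | nil => simp at h
  | cons b l ih =>
    rw [sz_cons]
    rcases List.mem_cons.1 h with rfl | h
    · omega
    · have := ih h; omega

lemma length_lt_sz (l : List α) : l.length < sz l := by
  induction l with
  | nil => simp [sz_nil]
  | cons b l ih => rw [sz_cons, List.length_cons]; have := sz_pos b; omega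

lemma sz_append (l l' : List α) : sz (l ++ l') + 1 = sz l + sz l' := by
  induction l with
  | nil => simp [sz_nil]; omega
  | cons b l ih => rw [List.cons_append, sz_cons, sz_cons]; omega

namespace PolyTime

lemma id : PolyTime (fun a : α => a) := of_enc_eq fun _ => rfl

lemma pair {f : α → β} {g : α → γ} (hf : PolyTime f) (hg : PolyTime g) :
    PolyTime (fun a => (f a, g a)) := of_enc_eq_cons hf hg fun _ => rfl

lemma fst {f : α → β × γ} (hf : PolyTime f) : PolyTime (fun a => (f a).1) :=
  (of_enc_eq_hd (f := Prod.fst) fun _ => rfl).comp hf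

lemma snd {f : α → β × γ} (hf : PolyTime f) : PolyTime (fun a => (f a).2) :=
  (of_enc_eq_tl (f := Prod.snd) fun _ => rfl).comp hf

lemma cons {f : α → β} {g : α → List β} (hf : PolyTime f) (hg : PolyTime g) :
    PolyTime (fun a => f a :: g a) := of_enc_eq_cons hf hg fun _ => rfl

lemma tail {f : α → List β} (hf : PolyTime f) : PolyTime (fun a => (f a).tail) :=
  (of_enc_eq_tl (f := List.tail) fun l => by cases l <;> rfl).comp hf

lemma ite {c : α → Bool} {f g : α → β} (hc : PolyTime c) (hf : PolyTime f) (hg : PolyTime g) :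
    PolyTime (fun a => if c a then f a else g a) :=
  of_branch hc hf hg (fun a h => by cases e : c a <;> simp_all [enc, Data.ofBool])
    (fun a h => by cases e : c a <;> simp_all [enc, Data.ofBool])

lemma of_data {f : α → β} (h : PolyTime (fun a => enc (f a))) : PolyTime f := h

lemma headD {f : α → List β} (hf : PolyTime f) (b : β) : PolyTime (fun a => (f a).headD b) := by
  have h : PolyTime (fun a => (enc (f a)).hd) :=
    (of_enc_eq_hd (f := fun l : List β => (enc l).hd) fun _ => rfl).comp hf
  refine of_data (of_branch hf h (const (enc b)) (fun a ha => ?_) fun a ha => ?_)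
  · cases e : f a with
    | nil => simp [e, enc_nil] at ha
    | cons b l => rfl
  · cases e : f a with
    | nil => rfl
    | cons b l => simp [e, enc_cons] at ha

/-- The variables `N + 1`, `N + 2`, `N + 3` hold the parameter, the remaining list and the
accumulator, out of reach of the step program `q`. The last hypothesis speaks of all splittings of
the list, so that it passes to the tail in the induction: `K` bounds the time of each step and `S`
the size of each accumulator. -/
lemma exec_fold {step : α → β → γ → β} {q : Program} {N : ℕ} {U : α × γ × β → ℕ}
    (hq : q.Computes N (fun z : α × γ × β => step z.1 z.2.2 z.2.1) U) (a : α) (K S : ℕ) (l : List γ) :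
    ∀ (b : β) (s : Store), s (N + 1) = enc a → s (N + 2) = enc l → s (N + 3) = enc b →
      sz l ≤ S →
      (∀ l₁ c l₂, l = l₁ ++ c :: l₂ → U (a, c, l₁.foldl (step a) b) ≤ K ∧
        sz (l₁.foldl (step a) b) ≤ S ∧ sz (step a (l₁.foldl (step a) b) c) ≤ S) →
      ∃ t s', Exec (.loop (.var (N + 2)) (.seq (.assign 0 (.cons (.var (N + 1))
        (.cons (.hd (.var (N + 2))) (.var (N + 3))))) (.seq q (.seq (.assign (N + 3) (.var 0))
          (.assign (N + 2) (.tl (.var (N + 2)))))))) s t s' ∧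
        t ≤ (l.length + 1) * (20 + 2 * sz a + 10 * S + K) ∧
        s' (N + 3) = enc (l.foldl (step a) b) ∧ ∀ i, N + 3 < i → s' i = s i := by
  induction l with
  | nil =>
    intro b s h1 h2 h3 h4 _
    refine ⟨_, _, .loop_false (by simp [Expr.eval, h2, enc_nil]), ?_, h3, fun _ _ => rfl⟩
    simp only [Expr.cost, h2]
    change 1 + sz ([] : List γ) ≤ _
    simp
    omega
  | cons c l ih =>
    intro b s h1 h2 h3 h4 h5
    obtain ⟨hU, hS, hS'⟩ := h5 [] c l rfl
    rw [List.foldl_nil] at hU hS hS'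
    have x1 := Exec.assign 0 (.cons (.var (N + 1)) (.cons (.hd (.var (N + 2))) (.var (N + 3)))) s
    simp only [Expr.eval, h1, h2, h3, enc_cons, Data.hd] at x1
    obtain ⟨t, s₁, q1, q2, q3, q4⟩ := hq (a, c, b)
      (Function.update s 0 (.cons (enc a) (.cons (enc c) (enc b)))) (by simp [enc_pair])
    have e1 : s₁ (N + 1) = enc a := by rw [q4 _ (by omega)]; simp [h1]
    have e2 : s₁ (N + 2) = enc (c :: l) := by rw [q4 _ (by omega)]; simp [h2]
    have x2 := Exec.assign (N + 3) (.var 0) s₁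
    have x3 := Exec.assign (N + 2) (.tl (.var (N + 2))) (Function.update s₁ (N + 3) (s₁ 0))
    simp only [Expr.eval] at x2 x3
    rw [Function.update_of_ne (by omega : N + 2 ≠ N + 3), e2, q3, enc_cons, Data.tl] at x3
    rw [q3] at x2
    rw [sz_cons] at h4
    obtain ⟨u, s₂, y1, y2, y3, y4⟩ := ih (step a b c)
      (Function.update (Function.update s₁ (N + 3) (enc (step a b c))) (N + 2) (enc l))
      (by simp [e1]) (by simp) (by simp) (by omega) (fun l₁ c' l₂ h => by
        simpa using h5 (c :: l₁) c' l₂ (by simp [h]))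
    refine ⟨_, _, .loop_true (by simp [Expr.eval, h2, enc_cons]) (.seq x1 (.seq q1 (.seq x2 x3))) y1,
      ?_, y3, ?_⟩
    · simp only [Expr.cost, Expr.eval, Data.size, h1, h2, h3, q3, e2, enc_cons, Data.hd, Data.tl,
        Function.update_of_ne (by omega : N + 2 ≠ N + 3)]
      simp only [sz] at hS hS' h4 y2 ⊢
      rw [List.length_cons, add_mul (l.length + 1), one_mul]
      generalize (l.length + 1) * _ = Z at *
      have := hU
      have := q2
      omega
    · intro i hi
      rw [y4 i hi, Function.update_of_ne (by omega), Function.update_of_ne (by omega),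
        q4 i (by omega), Function.update_of_ne (by omega)]

/-- Folds are computable in polynomial time if the intermediate results have polynomial size. -/
lemma foldl_of_size {step : α → β → γ → β} {l : α → List γ} {b : α → β}
    (hstep : PolyTime (fun z : α × γ × β => step z.1 z.2.2 z.2.1)) (hl : PolyTime l)
    (hb : PolyTime b) {S : α → ℕ} (hS : PolyBdd S)
    (h : ∀ a l₁ l₂, l a = l₁ ++ l₂ → sz (l₁.foldl (step a) (b a)) ≤ S a) :
    PolyTime (fun a => (l a).foldl (step a) (b a)) := by
  have hsz : PolyBdd (fun a => sz ((l a).foldl (step a) (b a))) :=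
    hS.mono fun a => h a (l a) [] (by simp)
  obtain ⟨p, N₁, T, hT, hp, -⟩ := hl.pair hb
  obtain ⟨q, N₂, U, hU, hq, -⟩ := hstep
  obtain ⟨G, hG, hUG, hGb⟩ := hU.exists_monotone
  obtain ⟨N, hN₁, hN₂⟩ : ∃ N, N₁ ≤ N ∧ N₂ ≤ N := ⟨max N₁ N₂, le_max_left _ _, le_max_right _ _⟩
  have hp := hp.mono hN₁
  have hq := hq.mono hN₂
  have k := fun n => PolyBdd.const (α := α) n
  have i := PolyBdd.self (α := α)
  refine ⟨.seq (.assign (N + 1) (.var 0)) (.seq p (.seq (.assign (N + 2) (.hd (.var 0)))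
    (.seq (.assign (N + 3) (.tl (.var 0))) (.seq (.loop (.var (N + 2)) (.seq (.assign 0 (.cons
      (.var (N + 1)) (.cons (.hd (.var (N + 2))) (.var (N + 3))))) (.seq q (.seq
        (.assign (N + 3) (.var 0)) (.assign (N + 2) (.tl (.var (N + 2)))))))) (.assign 0
          (.var (N + 3))))))), N + 3,
    fun a => T a + (sz a + 10 + 4 * sz (l a) + 4 * S a + sz (l a) * (20 + 2 * sz a +
      10 * (sz (l a) + S a) + G (2 + sz a + sz (l a) + S a))), ?_, ?_, hsz⟩
  · exact hT.add ((((i.add (k 10)).add ((k 4).mul hl.size)).add ((k 4).mul hS)).add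
      (hl.size.mul ((((k 20).add ((k 2).mul i)).add ((k 10).mul (hl.size.add hS))).add
        (hGb _ ((((k 2).add i).add hl.size).add hS)))))
  · intro a s hs
    obtain ⟨t, s₁, p1, p2, p3, p4⟩ := hp a (Function.update s (N + 1) (s 0)) (by simp [hs])
    have e1 : s₁ (N + 1) = enc a := by rw [p4 _ (by omega)]; simp [hs]
    have x1 := Exec.assign (N + 1) (.var 0) s
    have x2 := Exec.assign (N + 2) (.hd (.var 0)) s₁
    simp only [Expr.eval, p3, enc_pair, Data.hd] at x1 x2
    have x3 := Exec.assign (N + 3) (.tl (.var 0)) (Function.update s₁ (N + 2) (enc (l a)))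
    simp only [Expr.eval] at x3
    rw [Function.update_of_ne (by omega : 0 ≠ N + 2), p3, enc_pair, Data.tl] at x3
    have hb := h a [] (l a) rfl
    rw [List.foldl_nil] at hb
    obtain ⟨u, s₂, y1, y2, y3, y4⟩ := exec_fold hq a (G (2 + sz a + sz (l a) + S a))
      (sz (l a) + S a) (l a) (b a)
      (Function.update (Function.update s₁ (N + 2) (enc (l a))) (N + 3) (enc (b a)))
      (by simp [e1]) (by simp) (by simp) (by omega) (by
        intro l₁ c l₂ hl
        have h1 := h a l₁ (c :: l₂) hl
        -- The accumulator after the step is the fold over one more element, so the same bound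
        -- covers it.
        have h2 := h a (l₁ ++ [c]) l₂ (by simp [hl])
        rw [List.foldl_append, List.foldl_cons, List.foldl_nil] at h2
        have h3 : sz c ≤ sz (l a) := sz_le_of_mem (by simp [hl])
        refine ⟨(hUG _).trans (hG ?_), by omega, by omega⟩
        simp only [sz_pair]
        omega)
    have x4 := Exec.assign 0 (.var (N + 3)) s₂
    refine ⟨_, _, .seq x1 (.seq p1 (.seq x2 (.seq x3 (.seq y1 x4)))), ?_, ?_, ?_⟩
    · have hS := h a (l a) [] (by simp)
      simp only [Expr.cost, Expr.eval, Data.size, hs, p3, y3, enc_pair, Data.hd, Data.tl,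
        Function.update_of_ne (by omega : 0 ≠ N + 2)]
      have := Nat.mul_le_mul_right (20 + 2 * sz a + 10 * (sz (l a) + S a) +
        G (2 + sz a + sz (l a) + S a))
        (Nat.succ_le_of_lt (length_lt_sz (l a)))
      rw [Nat.succ_eq_add_one] at this
      simp only [sz] at *
      generalize _ * (20 + _) = Z at *
      generalize _ * (20 + _) = W at *
      have := p2
      omega
    · simp [Expr.eval, y3]
    · intro i hi
      rw [Function.update_of_ne (by omega), y4 i hi, Function.update_of_ne (by omega),
        Function.update_of_ne (by omega), p4 i (by omega), Function.update_of_ne (by omega)]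

/-- Folds are computable in polynomial time if every step adds a polynomial amount to the size. -/
lemma foldl {step : α → β → γ → β} {l : α → List γ} {b : α → β}
    (hstep : PolyTime (fun z : α × γ × β => step z.1 z.2.2 z.2.1)) (hl : PolyTime l)
    (hb : PolyTime b) {S : α × γ → ℕ} (hS : PolyBdd S)
    (h : ∀ a c b, sz (step a b c) ≤ sz b + S (a, c)) :
    PolyTime (fun a => (l a).foldl (step a) (b a)) := by
  obtain ⟨G, hG, hSG, hGb⟩ := hS.exists_monotone
  refine foldl_of_size hstep hl hb (S := fun a => sz (b a) + sz (l a) * G (1 + sz a + sz (l a)))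
    (hb.size.add (hl.size.mul (hGb _ (((PolyBdd.const 1).add .self).add hl.size)))) ?_
  -- The growth `S (a, c)` does not involve the accumulator, so the contributions of the steps add
  -- up. Growth by a factor in each step could give exponential size.
  have key : ∀ (a : α) (M : ℕ) (l₁ : List γ), (∀ c ∈ l₁, sz c ≤ M) → ∀ b,
      sz (l₁.foldl (step a) b) ≤ sz b + l₁.length * G (1 + sz a + M) := by
    intro a M l₁
    induction l₁ with
    | nil => simp
    | cons c l₁ ih =>
      intro hM b
      have h1 := ih (fun c hc => hM c (by simp [hc])) (step a b c)
      have h2 := h a c b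
      have h3 : S (a, c) ≤ G (1 + sz a + M) := (hSG _).trans (hG (by
        rw [sz_pair]; have := hM c (by simp); omega))
      rw [List.foldl_cons, List.length_cons, add_mul, one_mul]
      omega
  intro a l₁ l₂ hl
  refine (key a (sz (l a)) l₁ (fun c hc => sz_le_of_mem (by simp [hl, hc])) (b a)).trans ?_
  have : l₁.length ≤ sz (l a) := by
    have := length_lt_sz (l a)
    rw [hl, List.length_append] at this
    rw [hl]
    omega
  gcongr

end PolyTime

/-! ## Operations on lists -/

lemma sz_bool_le (b : Bool) : sz b ≤ 3 := by cases b <;> decide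

namespace PolyTime

lemma congr {f g : α → β} (hf : PolyTime f) (h : ∀ a, f a = g a) : PolyTime g := by
  rwa [← funext h]

lemma reverse {l : α → List β} (hl : PolyTime l) : PolyTime (fun a => (l a).reverse) := by
  refine (foldl (step := fun (_ : α) (acc : List β) c => c :: acc) (S := fun z : α × β => 1 + sz z.2)
    (cons (fst (snd id)) (snd (snd id))) hl (const []) ((PolyBdd.const 1).add (size (snd id)))
    (fun a c b => by rw [sz_cons]; dsimp only; omega)).congr fun a => ?_
  simp

lemma map {f : α → γ → β} {l : α → List γ} (hf : PolyTime (fun z : α × γ => f z.1 z.2))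
    (hl : PolyTime l) : PolyTime (fun a => (l a).map (f a)) := by
  refine (reverse (foldl (step := fun a (acc : List β) c => f a c :: acc)
    (S := fun z : α × γ => 1 + sz (f z.1 z.2))
    (cons (hf.comp (pair (fst id) (fst (snd id)))) (snd (snd id))) hl (const [])
    ((PolyBdd.const 1).add hf.size) (fun a c b => by rw [sz_cons]; dsimp only; omega))).congr fun a => ?_
  have : ∀ (l : List γ) (b : List β), (l.foldl (fun acc c => f a c :: acc) b) =
      (l.map (f a)).reverse ++ b := by
    intro l
    induction l with
    | nil => simp
    | cons c l ih => intro b; simp [ih]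
  simp [this]

lemma append {l l' : α → List β} (hl : PolyTime l) (hl' : PolyTime l') :
    PolyTime (fun a => l a ++ l' a) := by
  refine (foldl (step := fun (_ : α) (acc : List β) c => c :: acc) (S := fun z : α × β => 1 + sz z.2)
    (cons (fst (snd id)) (snd (snd id))) hl.reverse hl' ((PolyBdd.const 1).add (size (snd id)))
    (fun a c b => by rw [sz_cons]; dsimp only; omega)).congr fun a => ?_
  simp

lemma flatMap {f : α → γ → List β} {l : α → List γ} (hf : PolyTime (fun z : α × γ => f z.1 z.2))
    (hl : PolyTime l) : PolyTime (fun a => (l a).flatMap (f a)) := by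
  refine (foldl (step := fun a (acc : List β) c => acc ++ f a c)
    (S := fun z : α × γ => sz (f z.1 z.2))
    (append (snd (snd id)) (hf.comp (pair (fst id) (fst (snd id))))) hl (const [])
    hf.size (fun a c b => by have := sz_append b (f a c); dsimp only; omega)).congr fun a => ?_
  rw [List.flatMap_eq_foldl]

lemma filter {f : α → γ → Bool} {l : α → List γ} (hf : PolyTime (fun z : α × γ => f z.1 z.2))
    (hl : PolyTime l) : PolyTime (fun a => (l a).filter (f a)) := by
  refine (flatMap (f := fun a c => if f a c then [c] else [])
    (ite hf (cons (snd id) (const [])) (const [])) hl).congr fun a => ?_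
  induction l a with
  | nil => rfl
  | cons c l ih =>
    rw [List.flatMap_cons, ih, List.filter_cons]
    split <;> simp

lemma not {f : α → Bool} (hf : PolyTime f) : PolyTime (fun a => !(f a)) :=
  (ite hf (const false) (const true)).congr fun a => by cases f a <;> rfl

lemma or {f g : α → Bool} (hf : PolyTime f) (hg : PolyTime g) : PolyTime (fun a => f a || g a) :=
  (ite hf (const true) hg).congr fun a => by cases f a <;> rfl

lemma and {f g : α → Bool} (hf : PolyTime f) (hg : PolyTime g) : PolyTime (fun a => f a && g a) :=
  (ite hf hg (const false)).congr fun a => by cases f a <;> rfl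

lemma xor {f g : α → Bool} (hf : PolyTime f) (hg : PolyTime g) : PolyTime (fun a => f a ^^ g a) :=
  (ite hf hg.not hg).congr fun a => by cases f a <;> simp

lemma any {f : α → γ → Bool} {l : α → List γ} (hf : PolyTime (fun z : α × γ => f z.1 z.2))
    (hl : PolyTime l) : PolyTime (fun a => (l a).any (f a)) := by
  refine (foldl (step := fun a (acc : Bool) c => acc || f a c)
    (S := fun z : α × γ => 3)
    (or (snd (snd id)) (hf.comp (pair (fst id) (fst (snd id))))) hl (const false)
    (.const 3) (fun a c b => by have := sz_bool_le (b || f a c); omega)).congr fun a => ?_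
  have : ∀ (l : List γ) (b : Bool), l.foldl (fun acc c => acc || f a c) b = (b || l.any (f a)) := by
    intro l
    induction l with
    | nil => simp
    | cons c l ih => intro b; simp [ih, Bool.or_assoc]
  simpa using this (l a) false

/-! ## Natural numbers in unary notation -/

lemma succ {f : α → ℕ} (hf : PolyTime f) : PolyTime (fun a => f a + 1) :=
  of_enc_eq_cons (const Data.nil) hf fun _ => rfl

/-- A unary numeral is itself a list, so `g a` can drive the loop that takes predecessors. -/
lemma sub {f g : α → ℕ} (hf : PolyTime f) (hg : PolyTime g) : PolyTime (fun a => f a - g a) := by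
  have h1 : PolyTime (fun n : ℕ => List.replicate n Data.nil) :=
    of_enc_eq fun n => by simp [enc, Data.ofUnary]
  have h2 : PolyTime (fun n : ℕ => n - 1) := of_enc_eq_tl fun n => by cases n <;> rfl
  refine (foldl (step := fun (_ : α) n _ => n - 1) (S := fun _ => 0) (h2.comp (snd (snd id)))
    (h1.comp hg) hf (.const 0) fun a c n => ?_).congr fun a => ?_
  · have : ∀ n, sz (n + 1) = 2 + sz n := fun n => by
      change 1 + 1 + sz n = _
      omega
    cases n with
    | zero => simp
    | succ n => rw [this]; simp
  · induction g a with
    | zero => rfl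
    | succ n ih => rw [List.replicate_succ', List.foldl_append, ih]; rfl

lemma eq {f g : α → ℕ} (hf : PolyTime f) (hg : PolyTime g) :
    PolyTime (fun a => decide (f a = g a)) := by
  have h : PolyTime (fun n : ℕ => decide (n = 0)) :=
    of_branch id (const false) (const true) (fun n h => by cases n <;> simp_all [enc, Data.ofUnary, Data.ofList])
      fun n h => by cases n <;> simp_all [enc, Data.ofUnary, Data.ofList, List.replicate_succ]
  -- Two numbers are equal iff both truncated differences vanish.
  refine ((h.comp (hf.sub hg)).and (h.comp (hg.sub hf))).congr fun a => ?_
  rw [← Bool.decide_and, decide_eq_decide]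
  omega

lemma mem {f : α → ℕ} {l : α → List ℕ} (hf : PolyTime f) (hl : PolyTime l) :
    PolyTime (fun a => decide (f a ∈ l a)) := by
  refine (any (f := fun a n => decide (f a = n)) (eq (hf.comp (fst id)) (snd id)) hl).congr fun a => ?_
  rw [Bool.eq_iff_iff]
  simp

end PolyTime

/-! ## Binary arithmetic and the order of the rational numbers -/

/-- The number with given binary digits, least significant first. -/
def bitsVal : List Bool → ℕ
  | [] => 0
  | b :: l => b.toNat + 2 * bitsVal l

lemma bitsVal_append (l l' : List Bool) :
    bitsVal (l ++ l') = bitsVal l + 2 ^ l.length * bitsVal l' := by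
  induction l with
  | nil => simp [bitsVal]
  | cons b l ih => simp [bitsVal, ih]; ring

lemma bitsVal_bits (n : ℕ) : bitsVal n.bits = n := by
  induction n using Nat.binaryRec' with
  | zero => simp [bitsVal]
  | bit b n h ih => rw [Nat.bits_append_bit n b h, bitsVal, ih, Nat.bit_val]; omega

/-- One step of the addition of binary numbers: the state consists of the remaining digits of the
summands, the carry and the digits of the sum in reverse. -/
def addStep (s : List Bool × List Bool × Bool × List Bool) : List Bool × List Bool × Bool × List Bool :=
  let a := s.1.headD false
  let b := s.2.1.headD false
  (s.1.tail, s.2.1.tail, if a then b || s.2.2.1 else b && s.2.2.1, (a ^^ (b ^^ s.2.2.1)) :: s.2.2.2)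

/-- Addition of binary numbers. -/
def addBits (x y : List Bool) : List Bool :=
  let s := (x ++ y).foldl (fun s _ => addStep s) (x, y, false, [])
  (s.2.2.1 :: s.2.2.2).reverse

lemma bitsVal_headD_tail (x : List Bool) :
    bitsVal x = (x.headD false).toNat + 2 * bitsVal x.tail := by
  cases x <;> simp [bitsVal]

/-- The loop invariant: the digits already produced, plus the shifted sum of the remaining digits
and the carry, is constant. The list `l` is only a clock, long enough to exhaust both summands;
exhausted summands supply the digit `false`. -/
lemma foldl_addStep (l : List Bool) : ∀ (x y : List Bool) (c : Bool) (o : List Bool),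
    x.length ≤ l.length → y.length ≤ l.length →
    bitsVal (((l.foldl (fun s _ => addStep s) (x, y, c, o)).2.2.1 ::
      (l.foldl (fun s _ => addStep s) (x, y, c, o)).2.2.2).reverse) =
      bitsVal o.reverse + 2 ^ o.length * (bitsVal x + bitsVal y + c.toNat) := by
  induction l with
  | nil =>
    intro x y c o hx hy
    have hx : x = [] := by simpa using hx
    have hy : y = [] := by simpa using hy
    simp [hx, hy, bitsVal_append, bitsVal]
  | cons d l ih =>
    intro x y c o hx hy
    rw [List.foldl_cons, addStep, ih _ _ _ _ (by simp at *; omega) (by simp at *; omega),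
      bitsVal_headD_tail x, bitsVal_headD_tail y, List.reverse_cons, bitsVal_append]
    simp only [List.length_reverse, List.length_cons, bitsVal]
    cases x.headD false <;> cases y.headD false <;> cases c <;> simp <;> ring

lemma bitsVal_addBits (x y : List Bool) : bitsVal (addBits x y) = bitsVal x + bitsVal y := by
  rw [addBits, foldl_addStep _ _ _ _ _ (by simp) (by simp)]
  simp [bitsVal]

lemma length_addBits (x y : List Bool) : (addBits x y).length = x.length + y.length + 1 := by
  have : ∀ (l : List Bool) s, (l.foldl (fun s _ => addStep s) s).2.2.2.length =
      s.2.2.2.length + l.length := by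
    intro l
    induction l with
    | nil => simp
    | cons d l ih => intro s; rw [List.foldl_cons, ih, addStep]; simp; omega
  simp [addBits, this]

lemma PolyTime.addBits {f g : α → List Bool} (hf : PolyTime f) (hg : PolyTime g) :
    PolyTime (fun a => addBits (f a) (g a)) := by
  have hs : PolyTime addStep := by
    have a := headD (fst (id (α := List Bool × List Bool × Bool × List Bool))) false
    have b := headD (fst (snd (id (α := List Bool × List Bool × Bool × List Bool)))) false
    have c := fst (snd (snd (id (α := List Bool × List Bool × Bool × List Bool))))
    exact pair (tail (fst id)) (pair (tail (fst (snd id))) (pair (ite a (b.or c) (b.and c))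
      (cons (a.xor (b.xor c)) (snd (snd (snd id))))))
  have h := foldl (step := fun (_ : α) s (_ : Bool) => addStep s) (S := fun _ => 7)
    (hs.comp (snd (snd id))) (hf.append hg)
    (hf.pair (hg.pair ((const false).pair (const [])))) (.const 7) fun a _ s => ?_
  · exact reverse (cons (fst (snd (snd h))) (snd (snd (snd h))))
  · obtain ⟨x, y, c, o⟩ := s
    have h1 : sz x.tail ≤ sz x := by cases x <;> simp [sz_cons]
    have h2 : sz y.tail ≤ sz y := by cases y <;> simp [sz_cons]
    simp only [addStep, sz_pair, sz_cons]
    have h3 := sz_bool_le (if x.headD false then y.headD false || c else y.headD false && c)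
    have h4 := sz_bool_le (x.headD false ^^ (y.headD false ^^ c))
    have := sz_pos c
    omega

/-- Multiplication of binary numbers. -/
def mulBits (x y : List Bool) : List Bool :=
  x.reverse.foldl (fun o b => if b then addBits (false :: o) y else false :: o) []

lemma bitsVal_mulBits (x y : List Bool) : bitsVal (mulBits x y) = bitsVal x * bitsVal y := by
  -- This is Horner's scheme from the most significant digit; undoing the reversal gives a right
  -- fold that matches the recursion of `bitsVal`.
  rw [mulBits, List.foldl_reverse]
  induction x with
  | nil => simp [bitsVal]
  | cons b x ih =>
    rw [List.foldr_cons]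
    cases b
    · simp [bitsVal, ih]; ring
    · simp [bitsVal, ih, bitsVal_addBits]; ring

lemma sz_bits_le (l : List Bool) : sz l ≤ 4 * l.length + 1 := by
  induction l with
  | nil => simp [sz_nil]
  | cons b l ih => have := sz_bool_le b; rw [sz_cons, List.length_cons]; omega

/-- An addition may turn digits `false` into `true`, whose trees are larger, so the growth in size
is not evidently additive. The number of digits does grow additively, and it bounds the size by
`sz_bits_le`. -/
lemma PolyTime.mulBits {f g : α → List Bool} (hf : PolyTime f) (hg : PolyTime g) :
    PolyTime (fun a => mulBits (f a) (g a)) := by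
  have k := fun n => PolyBdd.const (α := α) n
  have hs : PolyTime (fun z : α × Bool × List Bool =>
      if z.2.1 then QAut.addBits (false :: z.2.2) (g z.1) else false :: z.2.2) :=
    ite (fst (snd id)) (addBits (cons (const false) (snd (snd id))) (hg.comp (fst id)))
      (cons (const false) (snd (snd id)))
  refine foldl_of_size (step := fun a o b => if b then QAut.addBits (false :: o) (g a) else false :: o)
    hs hf.reverse (const [])
    (S := fun a => 4 * (sz (f a) * (sz (g a) + 2)) + 1)
    (((k 4).mul (hf.size.mul (hg.size.add (k 2)))).add (k 1)) ?_
  intro a l₁ l₂ hl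
  refine (sz_bits_le _).trans ?_
  have key : ∀ (l : List Bool) (o : List Bool),
      (l.foldl (fun o b => if b then QAut.addBits (false :: o) (g a) else false :: o) o).length ≤
        o.length + l.length * (sz (g a) + 2) := by
    intro l
    induction l with
    | nil => simp
    | cons b l ih =>
      intro o
      rw [List.foldl_cons, List.length_cons, add_mul, one_mul]
      refine (ih _).trans ?_
      have := length_lt_sz (g a)
      cases b
      · simp; omega
      · simp [length_addBits]; omega
  have h1 := key l₁ []
  have h2 : l₁.length ≤ sz (f a) := by
    have h3 := congrArg List.length hl
    have := length_lt_sz (f a)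
    simp at h3
    omega
  have h3 := Nat.mul_le_mul_right (sz (g a) + 2) h2
  simp only [List.length_nil, zero_add] at h1
  omega

/-- One step of the comparison of binary numbers. -/
def ltStep (s : List Bool × List Bool × Bool) : List Bool × List Bool × Bool :=
  (s.1.tail, s.2.1.tail,
    if s.1.headD false ^^ s.2.1.headD false then s.2.1.headD false else s.2.2)

/-- Comparison of binary numbers. -/
def ltBits (x y : List Bool) : Bool :=
  ((x ++ y).foldl (fun s _ => ltStep s) (x, y, false)).2.2

/-- Digits arrive least significant first, so a later difference overrides the verdict `c` on the
earlier digits, which survives only if the remaining digits agree. -/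
lemma foldl_ltStep (l : List Bool) : ∀ (x y : List Bool) (c : Bool),
    x.length ≤ l.length → y.length ≤ l.length →
    ((l.foldl (fun s _ => ltStep s) (x, y, c)).2.2 = true ↔
      bitsVal x < bitsVal y ∨ bitsVal x = bitsVal y ∧ c = true) := by
  induction l with
  | nil =>
    intro x y c hx hy
    have hx : x = [] := by simpa using hx
    have hy : y = [] := by simpa using hy
    simp [hx, hy]
  | cons d l ih =>
    intro x y c hx hy
    rw [List.foldl_cons, ltStep, ih _ _ _ (by simp at *; omega) (by simp at *; omega),
      bitsVal_headD_tail x, bitsVal_headD_tail y]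
    dsimp only
    cases x.headD false <;> cases y.headD false <;> simp <;> omega

lemma ltBits_iff (x y : List Bool) : ltBits x y = true ↔ bitsVal x < bitsVal y := by
  rw [ltBits, foldl_ltStep _ _ _ _ (by simp) (by simp)]
  simp

lemma PolyTime.ltBits {f g : α → List Bool} (hf : PolyTime f) (hg : PolyTime g) :
    PolyTime (fun a => ltBits (f a) (g a)) := by
  have hs : PolyTime ltStep := by
    have a := headD (fst (id (α := List Bool × List Bool × Bool))) false
    have b := headD (fst (snd (id (α := List Bool × List Bool × Bool)))) false
    exact pair (tail (fst id)) (pair (tail (fst (snd id))) (ite (a.xor b) b (snd (snd id))))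
  refine snd (snd (foldl (step := fun (_ : α) s (_ : Bool) => ltStep s) (S := fun _ => 3)
    (hs.comp (snd (snd id))) (hf.append hg) (hf.pair (hg.pair (const false))) (.const 3) ?_))
  rintro a - ⟨x, y, c⟩
  have h1 : sz x.tail ≤ sz x := by cases x <;> simp [sz_cons]
  have h2 : sz y.tail ≤ sz y := by cases y <;> simp [sz_cons]
  simp only [ltStep, sz_pair]
  have h3 := sz_bool_le (if x.headD false ^^ y.headD false then y.headD false else c)
  omega

/-- Cross-multiplication of absolute values after comparing signs: only the data present in the
encoding of a rational are used. -/
lemma rat_lt_iff (a b : ℚ) : a < b ↔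
    if a < 0 then (if b < 0 then b.num.natAbs * a.den < a.num.natAbs * b.den else True)
    else if b < 0 then False else a.num.natAbs * b.den < b.num.natAbs * a.den := by
  split_ifs with ha hb hb
  · have ha' := Rat.num_neg.2 ha
    have hb' := Rat.num_neg.2 hb
    rw [Rat.lt_iff, ← Int.ofNat_lt]
    push_cast
    rw [abs_of_neg ha', abs_of_neg hb']
    constructor <;> intro h <;> linarith
  · simp only [iff_true]; linarith
  · simp only [iff_false]; linarith
  · have ha' := Rat.num_nonneg.2 (not_lt.1 ha)
    have hb' := Rat.num_nonneg.2 (not_lt.1 hb)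
    rw [Rat.lt_iff, ← Int.ofNat_lt]
    push_cast
    rw [abs_of_nonneg ha', abs_of_nonneg hb']

lemma PolyTime.rat_lt {f g : α → ℚ} (hf : PolyTime f) (hg : PolyTime g) :
    PolyTime (fun a => decide (f a < g a)) := by
  have hn : PolyTime (fun q : ℚ => decide (q < 0)) := of_enc_eq_hd fun _ => rfl
  have hb : PolyTime (fun q : ℚ => (q.num.natAbs.bits, q.den.bits)) := of_enc_eq_tl fun _ => rfl
  have hfn := hn.comp hf
  have hgn := hn.comp hg
  have hfb := hb.comp hf
  have hgb := hb.comp hg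
  refine (ite hfn (ite hgn (ltBits (mulBits hgb.fst hfb.snd) (mulBits hfb.fst hgb.snd)) (const true))
    (ite hgn (const false) (ltBits (mulBits hfb.fst hgb.snd) (mulBits hgb.fst hfb.snd)))).congr
    fun a => ?_
  have h : decide (f a < g a) = true ↔ _ := decide_eq_true_iff.trans (rat_lt_iff (f a) (g a))
  rw [Bool.eq_iff_iff, h]
  simp only [decide_eq_true_iff]
  split_ifs <;> simp [ltBits_iff, bitsVal_mulBits, bitsVal_bits]

lemma PolyTime.rat_le {f g : α → ℚ} (hf : PolyTime f) (hg : PolyTime g) :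
    PolyTime (fun a => decide (f a ≤ g a)) :=
  (hg.rat_lt hf).not.congr fun a => by rw [← decide_not]; simp

/-! ## Reachability in weighted graphs -/

/-- Edges of a weighted graph: source, weight, target. -/
abbrev Edge : Type := ℕ × ℚ × ℕ

/-- The transition table of an automaton. -/
abbrev Table : Type := List (List (List (ℚ × ℕ)))

/-- The successor relation of a graph. -/
def Succ (es : List Edge) (a b : ℕ) : Prop := ∃ x, (a, x, b) ∈ es

/-- Add the targets of all edges whose sources are in `S`. -/
def reachStep (es : List Edge) (S : List ℕ) : List ℕ :=
  es.foldl (fun S e => if decide (e.1 ∈ S) then e.2.2 :: S else S) S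

/-- The vertices reachable from `q`. -/
def reach (es : List Edge) (q : ℕ) : List ℕ :=
  es.foldl (fun S _ => reachStep es S) [q]

lemma subset_reachStep (es : List Edge) : ∀ S, S ⊆ reachStep es S := by
  unfold reachStep
  induction es with
  | nil => simp
  | cons e es ih =>
    intro S
    rw [List.foldl_cons]
    refine List.Subset.trans ?_ (ih _)
    split
    · exact List.subset_cons_self _ _
    · exact List.Subset.refl _

lemma mem_reachStep_of_mem {es : List Edge} {S : List ℕ} {a b : ℕ} (h : Succ es a b) (ha : a ∈ S) :
    b ∈ reachStep es S := by
  obtain ⟨x, h⟩ := h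
  obtain ⟨l₁, l₂, rfl⟩ := List.append_of_mem h
  have h1 := subset_reachStep l₁ S ha
  have h2 : reachStep (l₁ ++ (a, x, b) :: l₂) S = reachStep l₂ (b :: reachStep l₁ S) := by
    unfold reachStep at *
    rw [List.foldl_append, List.foldl_cons, if_pos (by simpa using h1)]
  rw [h2]
  exact subset_reachStep _ _ (by simp)

/-- The set is updated during the scan, so a single pass may follow several edges in a row; hence
the reflexive transitive closure. That a new vertex is the target of an edge serves to bound the
number of vertices in `mem_reach`. -/
lemma mem_reachStep {es : List Edge} {S : List ℕ} {b : ℕ} (h : b ∈ reachStep es S) :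
    b ∈ S ∨ (∃ e ∈ es, e.2.2 = b) ∧ ∃ a ∈ S, Relation.ReflTransGen (Succ es) a b := by
  have key : ∀ (l : List Edge), l ⊆ es → ∀ T : List ℕ,
      (∀ c ∈ T, c ∈ S ∨ (∃ e ∈ es, e.2.2 = c) ∧ ∃ a ∈ S, Relation.ReflTransGen (Succ es) a c) →
      ∀ c ∈ reachStep l T,
        c ∈ S ∨ (∃ e ∈ es, e.2.2 = c) ∧ ∃ a ∈ S, Relation.ReflTransGen (Succ es) a c := by
    intro l
    unfold reachStep
    induction l with
    | nil => simp
    | cons e l ih =>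
      intro hl T hT
      rw [List.foldl_cons]
      refine ih (fun x hx => hl (by simp [hx])) _ fun c hc => ?_
      split at hc
      · rename_i he
        rcases List.mem_cons.1 hc with rfl | hc
        · have he' : e ∈ es := hl (by simp)
          have hs : Succ es e.1 e.2.2 := ⟨e.2.1, he'⟩
          rcases hT e.1 (by simpa using he) with h | ⟨-, a, ha, h⟩
          · exact .inr ⟨⟨e, he', rfl⟩, e.1, h, .single hs⟩
          · exact .inr ⟨⟨e, he', rfl⟩, a, ha, h.tail hs⟩
        · exact hT c hc
      · exact hT c hc
  exact key es (List.Subset.refl _) S (fun c hc => .inl hc) b h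

lemma mem_reach (es : List Edge) (q p : ℕ) :
    p ∈ reach es q ↔ Relation.ReflTransGen (Succ es) q p := by
  rw [reach, List.foldl_const]
  set F : ℕ → List ℕ := fun m => (reachStep es)^[m] [q] with hF
  change p ∈ F es.length ↔ _
  have hF0 : F 0 = [q] := rfl
  have hFs : ∀ m, F (m + 1) = reachStep es (F m) := fun m => Function.iterate_succ_apply' _ _ _
  have hmono : ∀ {m m'}, m ≤ m' → F m ⊆ F m' := by
    intro m m' h
    induction h with
    | refl => exact List.Subset.refl _
    | step _ ih => exact List.Subset.trans ih (by rw [Nat.succ_eq_add_one, hFs]; exact subset_reachStep _ _)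
  have hsound : ∀ m, ∀ b ∈ F m, (b = q ∨ ∃ e ∈ es, e.2.2 = b) ∧ Relation.ReflTransGen (Succ es) q b := by
    intro m
    induction m with
    | zero => intro b hb; rw [hF0, List.mem_singleton] at hb; subst hb; exact ⟨.inl rfl, .refl⟩
    | succ m ih =>
      intro b hb
      rw [hFs] at hb
      rcases mem_reachStep hb with h | ⟨h, a, ha, hab⟩
      · exact ih b h
      · exact ⟨.inr h, (ih a ha).2.trans hab⟩
  refine ⟨fun h => (hsound _ p h).2, fun h => ?_⟩
  -- Only `q` and the targets of edges ever occur, at most `es.length + 1` vertices, so the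
  -- increasing sequence must stall within that many passes. A set at which it stalls is closed
  -- under successors.
  obtain ⟨m, hm, hc⟩ : ∃ m ≤ es.length, F (m + 1) ⊆ F m := by
    by_contra! hno
    have hcard : ∀ m ≤ es.length + 1, m + 1 ≤ (F m).toFinset.card := by
      intro m
      induction m with
      | zero => simp [hF0]
      | succ m ih =>
        intro hm
        have h1 := ih (by omega)
        have h2 : (F m).toFinset ⊂ (F (m + 1)).toFinset := by
          rw [Finset.ssubset_iff_subset_ne]
          refine ⟨fun x hx => ?_, fun heq => hno m (by omega) fun x hx => ?_⟩
          · exact List.mem_toFinset.2 (hmono (Nat.le_succ m) (List.mem_toFinset.1 hx))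
          · exact List.mem_toFinset.1 (heq ▸ List.mem_toFinset.2 hx)
        have := Finset.card_lt_card h2
        omega
    have h1 := hcard (es.length + 1) le_rfl
    have h2 : (F (es.length + 1)).toFinset ⊆ (q :: es.map (fun e => e.2.2)).toFinset := by
      intro b hb
      rcases (hsound _ b (List.mem_toFinset.1 hb)).1 with rfl | ⟨e, he, rfl⟩
      · simp
      · exact List.mem_toFinset.2 (List.mem_cons_of_mem _ (List.mem_map.2 ⟨e, he, rfl⟩))
    have h3 := (Finset.card_le_card h2).trans (List.toFinset_card_le _)
    simp at h3
    omega
  refine hmono hm ?_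
  induction h with
  | refl => exact hmono (Nat.zero_le m) (by simp [hF0])
  | tail _ hbc ih => exact hc (by rw [hFs]; exact mem_reachStep_of_mem hbc ih)

lemma PolyTime.reachStep {es : α → List Edge} {S : α → List ℕ} (he : PolyTime es) (hS : PolyTime S) :
    PolyTime (fun a => reachStep (es a) (S a)) := by
  refine foldl (step := fun (_ : α) S (e : Edge) => if decide (e.1 ∈ S) then e.2.2 :: S else S)
    (S := fun z : α × Edge => 1 + sz z.2) ?_ he hS ((PolyBdd.const 1).add (size (snd id))) ?_
  · exact ite (mem (fst (fst (snd id))) (snd (snd id)))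
      (cons (snd (snd (fst (snd id)))) (snd (snd id))) (snd (snd id))
  · rintro a ⟨p, x, q⟩ S
    dsimp only
    split
    · simp only [sz_cons, sz_pair]; omega
    · omega

/-- Duplicates are not removed, but a pass adds at most one vertex per edge. The growth is thus
independent of `S`, as `PolyTime.foldl` requires for iterating the pass. -/
lemma sz_reachStep_le (es : List Edge) : ∀ S, sz (QAut.reachStep es S) ≤ sz S + sz es := by
  unfold QAut.reachStep
  induction es with
  | nil => simp
  | cons e es ih =>
    intro S
    rw [List.foldl_cons]
    refine (ih _).trans ?_
    obtain ⟨p, x, q⟩ := e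
    split
    · simp only [sz_cons, sz_pair]; omega
    · simp only [sz_cons]; omega

lemma PolyTime.reach {es : α → List Edge} {q : α → ℕ} (he : PolyTime es) (hq : PolyTime q) :
    PolyTime (fun a => reach (es a) (q a)) :=
  foldl (step := fun a S (_ : Edge) => QAut.reachStep (es a) S) (S := fun z : α × Edge => sz (es z.1))
    (reachStep (he.comp (fst id)) (snd (snd id))) he (cons hq (const []))
    (he.comp (fst id)).size fun a _ S => sz_reachStep_le (es a) S

/-! ## The best value from a state -/

/-- The edge `e` lies on a cycle all of whose weights are at least that of `e` (on any cycle, if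
`sup` holds). -/
def onCycle (sup : Bool) (es : List Edge) (e : Edge) : Bool :=
  decide (e.1 ∈ reach (es.filter fun e' => sup || decide (e.2.1 ≤ e'.2.1)) e.2.2)

/-- The weights of the suitable edges that can be reached from `q`. -/
def cycleWeights (sup : Bool) (es : List Edge) (q : ℕ) : List ℚ :=
  (es.filter fun e => onCycle sup es e && decide (e.1 ∈ reach es q)).map fun e => e.2.1

/-- The maximum of a list of rational numbers. -/
def listMax (l : List ℚ) : ℚ := l.foldl (fun a b => if decide (a < b) then b else a) (l.headD 0)

/-- The largest value of a word that is read from the state `q`. -/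
def bestValue (sup : Bool) (es : List Edge) (q : ℕ) : ℚ := listMax (cycleWeights sup es q)

lemma listMax_spec {l : List ℚ} (hl : l ≠ []) : listMax l ∈ l ∧ ∀ x ∈ l, x ≤ listMax l := by
  have key : ∀ (l : List ℚ) (a : ℚ),
      (l.foldl (fun a b => if decide (a < b) then b else a) a) ∈ a :: l ∧
      ∀ x ∈ a :: l, x ≤ l.foldl (fun a b => if decide (a < b) then b else a) a := by
    intro l
    induction l with
    | nil => simp
    | cons b l ih =>
      intro a
      rw [List.foldl_cons]
      obtain ⟨h1, h2⟩ := ih (if decide (a < b) then b else a)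
      set m := List.foldl (fun a b => if decide (a < b) then b else a) (if decide (a < b) then b else a) l
      have h3 := h2 _ List.mem_cons_self
      refine ⟨?_, ?_⟩
      · rcases List.mem_cons.1 h1 with h | h
        · rw [h]; split <;> simp
        · simp [h]
      · intro x hx
        simp only [decide_eq_true_eq] at h3
        simp only [List.mem_cons] at hx
        rcases hx with rfl | rfl | hx
        · split_ifs at h3 <;> linarith
        · split_ifs at h3 <;> linarith
        · exact h2 x (by simp [hx])
  cases l with
  | nil => exact absurd rfl hl
  | cons a l =>
    obtain ⟨h1, h2⟩ := key (a :: l) a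
    refine ⟨?_, fun x hx => h2 x (List.mem_cons_of_mem _ hx)⟩
    rcases List.mem_cons.1 h1 with h | h
    · exact List.mem_cons.2 (.inl h)
    · exact h

lemma PolyTime.listMax {l : α → List ℚ} (hl : PolyTime l) : PolyTime (fun a => listMax (l a)) := by
  refine foldl (step := fun (_ : α) (a : ℚ) b => if decide (a < b) then b else a)
    (S := fun z : α × ℚ => sz z.2) ?_ hl (headD hl 0) (size (snd id)) fun a b c => ?_
  · exact ite (rat_lt (snd (snd id)) (fst (snd id))) (fst (snd id)) (snd (snd id))
  · dsimp only
    split <;> omega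

lemma PolyTime.onCycle (sup : Bool) {es : α → List Edge} {e : α → Edge} (hes : PolyTime es)
    (he : PolyTime e) : PolyTime (fun a => onCycle sup (es a) (e a)) := by
  have h1 : PolyTime (fun z : α × Edge => (e z.1).2.1) := fst (snd (he.comp (fst id)))
  have h2 : PolyTime (fun z : α × Edge => z.2.2.1) := fst (snd (snd id))
  have h3 : PolyTime (fun z : α × Edge => sup || decide ((e z.1).2.1 ≤ z.2.2.1)) :=
    or (const sup) (rat_le h1 h2)
  have h4 := filter (f := fun a (e' : Edge) => sup || decide ((e a).2.1 ≤ e'.2.1)) h3 hes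
  exact mem (fst he) (reach h4 (snd (snd he)))

lemma PolyTime.cycleWeights (sup : Bool) {es : α → List Edge} {q : α → ℕ} (hes : PolyTime es)
    (hq : PolyTime q) : PolyTime (fun a => cycleWeights sup (es a) (q a)) := by
  have h1 : PolyTime (fun z : α × Edge => es z.1) := hes.comp (fst id)
  have h2 : PolyTime (fun z : α × Edge => q z.1) := hq.comp (fst id)
  have h3 : PolyTime (fun z : α × Edge => z.2) := snd id
  have h4 := filter (f := fun a e => QAut.onCycle sup (es a) e && decide (e.1 ∈ QAut.reach (es a) (q a)))
    (and (onCycle sup h1 h3) (mem (fst h3) (reach h1 h2))) hes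
  exact map (f := fun (_ : α) (e : Edge) => e.2.1) (fst (snd h3)) h4

lemma PolyTime.bestValue (sup : Bool) {es : α → List Edge} {q : α → ℕ} (hes : PolyTime es)
    (hq : PolyTime q) : PolyTime (fun a => bestValue sup (es a) (q a)) :=
  listMax (cycleWeights sup hes hq)

/-! ## The decomposition of transition tables -/

/-- The rows of a table with their numbers. -/
def numberRows (t : Table) : List (ℕ × List (List (ℚ × ℕ))) :=
  (t.foldl (fun s row => (s.1 + 1, (s.1, row) :: s.2)) ((0 : ℕ), [])).2

/-- The edges of a table. -/
def tableEdges (t : Table) : List Edge :=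
  (numberRows t).flatMap fun r => r.2.flatMap fun cell => cell.map fun c => (r.1, c)

/-- Change the weights in a table. -/
def mapTable (f : ℚ × ℕ → ℚ) (t : Table) : Table :=
  t.map fun row => row.map fun cell => cell.map fun c => (f c, c.2)

/-- The weights of the safe part. -/
def safeWeight (sup : Bool) (es : List Edge) (c : ℚ × ℕ) : ℚ := bestValue sup es c.2

/-- The weights of the live part. -/
def liveWeight (sup : Bool) (es : List Edge) (i : ℕ) (c : ℚ × ℕ) : ℚ :=
  if decide (c.1 < bestValue sup es c.2) then c.1 else bestValue sup es i

/-- The decomposition of a table with an initial state. -/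
def decompose (sup : Bool) (A : ℕ × Table) : (ℕ × Table) × (ℕ × Table) :=
  ((A.1, mapTable (safeWeight sup (tableEdges A.2)) A.2),
    (A.1, mapTable (liveWeight sup (tableEdges A.2) A.1) A.2))

lemma foldl_numberRows (t : Table) : ∀ (n : ℕ) (acc : List (ℕ × List (List (ℚ × ℕ)))),
    t.foldl (fun s row => (s.1 + 1, (s.1, row) :: s.2)) (n, acc) =
      (n + t.length, ((t.zipIdx n).map Prod.swap).reverse ++ acc) := by
  induction t with
  | nil => simp
  | cons r t ih =>
    intro n acc
    rw [List.foldl_cons, ih]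
    simp
    omega

lemma mem_tableEdges {t : Table} {e : Edge} :
    e ∈ tableEdges t ↔ ∃ row cell, t[e.1]? = some row ∧ cell ∈ row ∧ e.2 ∈ cell := by
  obtain ⟨p, c⟩ := e
  simp only [tableEdges, numberRows, foldl_numberRows, List.append_nil, List.mem_flatMap,
    List.mem_reverse, List.mem_map, Prod.exists, List.mem_zipIdx_iff_getElem?, Prod.swap_prod_mk]
  constructor
  · rintro ⟨i, row, ⟨r, j, h1, h2⟩, cell, h3, x, y, h4, h5⟩
    simp only [Prod.mk.injEq] at h2 h5
    obtain ⟨rfl, rfl⟩ := h2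
    obtain ⟨rfl, rfl⟩ := h5
    exact ⟨r, cell, h1, h3, h4⟩
  · rintro ⟨row, cell, h1, h2, h3⟩
    exact ⟨p, row, ⟨row, p, h1, rfl⟩, cell, h2, c.1, c.2, h3, rfl⟩

lemma sz_nat (n : ℕ) : sz n = 2 * n + 1 := by
  induction n with
  | zero => rfl
  | succ n ih => change 1 + 1 + sz n = _; omega

lemma sz_list_le {l : List α} {M : ℕ} (h : ∀ a ∈ l, sz a ≤ M) : sz l ≤ l.length * (1 + M) + 1 := by
  induction l with
  | nil => simp [sz_nil]
  | cons a l ih =>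
    have h1 := ih fun b hb => h b (by simp [hb])
    have h2 := h a (by simp)
    rw [sz_cons, List.length_cons, add_mul, one_mul]
    omega

/-- Each step copies the counter out of the accumulator, so its growth depends on the accumulator;
the explicit form of the partial results bounds their sizes instead. -/
lemma PolyTime.numberRows {t : α → Table} (ht : PolyTime t) :
    PolyTime (fun a => numberRows (t a)) := by
  have k := fun n => PolyBdd.const (α := α) n
  refine snd (foldl_of_size (step := fun (_ : α) s (row : List (List (ℚ × ℕ))) =>
    (s.1 + 1, (s.1, row) :: s.2)) ?_ ht (const ((0 : ℕ), []))
    (S := fun a => 1 + 2 * sz (t a) + 1 + (sz (t a) * (1 + (3 * sz (t a) + 2)) + 1))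
    ((((k 1).add ((k 2).mul ht.size)).add (k 1)).add
      ((ht.size.mul ((k 1).add (((k 3).mul ht.size).add (k 2)))).add (k 1))) ?_)
  · have a := fst (snd (snd (id (α := α × List (List (ℚ × ℕ)) × ℕ × List (ℕ × List (List (ℚ × ℕ)))))))
    exact pair (succ a) (cons (pair a (fst (snd id))) (snd (snd (snd id))))
  · intro a l₁ l₂ h
    rw [foldl_numberRows, sz_pair, sz_nat, List.append_nil]
    have hl : l₁.length ≤ sz (t a) := by
      have := length_lt_sz (t a)
      rw [h, List.length_append] at this
      rw [h]
      omega
    have h1 : sz ((l₁.zipIdx 0).map Prod.swap).reverse ≤ _ :=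
      sz_list_le (M := 3 * sz (t a) + 2) fun r hr => by
        obtain ⟨i, row⟩ := r
        simp only [List.mem_reverse, List.mem_map, Prod.exists, List.mem_zipIdx_iff_getElem?,
          Prod.swap_prod_mk, Prod.mk.injEq] at hr
        obtain ⟨x, j, hx, rfl, rfl⟩ := hr
        obtain ⟨hj, hx⟩ := List.getElem?_eq_some_iff.1 hx
        have : sz x ≤ sz (t a) := sz_le_of_mem (by rw [h, ← hx]; simp)
        rw [sz_pair, sz_nat]
        omega
    have h2 := Nat.mul_le_mul_right (1 + (3 * sz (t a) + 2)) hl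
    simp only [List.length_reverse, List.length_map, List.length_zipIdx] at h1
    omega

lemma PolyTime.tableEdges {t : α → Table} (ht : PolyTime t) :
    PolyTime (fun a => tableEdges (t a)) := by
  have h1 : PolyTime (fun z : ((α × ℕ × List (List (ℚ × ℕ))) × List (ℚ × ℕ)) × ℚ × ℕ =>
      (z.1.1.2.1, z.2)) := pair (fst (snd (fst (fst id)))) (snd id)
  have h2 := map (f := fun (z : (α × ℕ × List (List (ℚ × ℕ))) × List (ℚ × ℕ)) (c : ℚ × ℕ) =>
    (z.1.2.1, c)) h1 (snd id)
  have h3 := flatMap (f := fun (z : α × ℕ × List (List (ℚ × ℕ))) (cell : List (ℚ × ℕ)) =>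
    cell.map fun c => (z.2.1, c)) h2 (snd (snd id))
  exact flatMap (f := fun (_ : α) (r : ℕ × List (List (ℚ × ℕ))) =>
    r.2.flatMap fun cell => cell.map fun c => (r.1, c)) h3 ht.numberRows

lemma PolyTime.mapTable {f : α → ℚ × ℕ → ℚ} {t : α → Table}
    (hf : PolyTime (fun z : α × ℚ × ℕ => f z.1 z.2)) (ht : PolyTime t) :
    PolyTime (fun a => mapTable (f a) (t a)) := by
  have h0 : PolyTime (fun z : ((α × List (List (ℚ × ℕ))) × List (ℚ × ℕ)) × ℚ × ℕ =>
      (z.1.1.1, z.2)) := pair (fst (fst (fst id))) (snd id)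
  have h1 : PolyTime (fun z : ((α × List (List (ℚ × ℕ))) × List (ℚ × ℕ)) × ℚ × ℕ =>
      (f z.1.1.1 z.2, z.2.2)) := pair (hf.comp h0) (snd (snd id))
  have h2 := map (f := fun (z : (α × List (List (ℚ × ℕ))) × List (ℚ × ℕ)) (c : ℚ × ℕ) =>
    (f z.1.1 c, c.2)) h1 (snd id)
  have h3 := map (f := fun (z : α × List (List (ℚ × ℕ))) (cell : List (ℚ × ℕ)) =>
    cell.map fun c => (f z.1 c, c.2)) h2 (snd id)
  exact map (f := fun a (row : List (List (ℚ × ℕ))) =>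
    row.map fun cell => cell.map fun c => (f a c, c.2)) h3 ht

lemma PolyTime.decompose (sup : Bool) : PolyTime (decompose sup) := by
  have he : PolyTime (fun A : ℕ × Table => QAut.tableEdges A.2) := tableEdges (snd id)
  have he' : PolyTime (fun z : (ℕ × Table) × ℚ × ℕ => QAut.tableEdges z.1.2) := he.comp (fst id)
  have hb : PolyTime (fun z : (ℕ × Table) × ℚ × ℕ => QAut.bestValue sup (QAut.tableEdges z.1.2) z.2.2) :=
    bestValue sup he' (snd (snd id))
  have hi : PolyTime (fun z : (ℕ × Table) × ℚ × ℕ => QAut.bestValue sup (QAut.tableEdges z.1.2) z.1.1) :=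
    bestValue sup he' (fst (fst id))
  have hx : PolyTime (fun z : (ℕ × Table) × ℚ × ℕ => z.2.1) := fst (snd id)
  have hl : PolyTime (fun z : (ℕ × Table) × ℚ × ℕ =>
      liveWeight sup (QAut.tableEdges z.1.2) z.1.1 z.2) := ite (rat_lt hx hb) hx hi
  have h1 : PolyTime (fun A : ℕ × Table => A.1) := fst id
  have h2 : PolyTime (fun A : ℕ × Table => A.2) := snd id
  exact pair (pair h1
      (mapTable (f := fun A : ℕ × Table => safeWeight sup (QAut.tableEdges A.2)) hb h2))
    (pair h1
      (mapTable (f := fun A : ℕ × Table => liveWeight sup (QAut.tableEdges A.2) A.1) hl h2))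

/-! ## Limit values of sequences with finitely many values -/

/-- `x` is the limit superior (`sup = true`) or the limit inferior (`sup = false`) of `u`, in a form
suitable for sequences with finitely many values. -/
def IsVal (sup : Bool) (u : ℕ → ℚ) (x : ℚ) : Prop :=
  (∃ᶠ i in Filter.atTop, u i = x) ∧
    ∀ᶠ i in Filter.atTop, if sup then u i ≤ x else x ≤ u i

/-- The value function for a given kind of limit. -/
noncomputable def limVal (sup : Bool) : (ℕ → ℚ) → ℝ := if sup then limSupVal else limInfVal

/-- Limits inferior and superior in `ℝ` need boundedness side conditions: the eventual inequality
gives boundedness, the frequent equality gives coboundedness. -/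
lemma IsVal.limVal_eq {sup : Bool} {u : ℕ → ℚ} {x : ℚ} (h : IsVal sup u x) : limVal sup u = x := by
  obtain ⟨h1, h2⟩ := h
  cases sup
  · simp only [Bool.false_eq_true, if_false] at h2
    have h2' : ∀ᶠ i in Filter.atTop, (x : ℝ) ≤ (u i : ℝ) := h2.mono fun i hi => by exact_mod_cast hi
    have h1' : ∃ᶠ i in Filter.atTop, (u i : ℝ) ≤ x := h1.mono fun i hi => by rw [hi]
    have hb : Filter.IsBoundedUnder (· ≥ ·) Filter.atTop (fun i => (u i : ℝ)) := ⟨x, by simpa using h2'⟩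
    have hc : Filter.IsCoboundedUnder (· ≥ ·) Filter.atTop (fun i => (u i : ℝ)) :=
      Filter.IsCoboundedUnder.of_frequently_le h1'
    exact le_antisymm (Filter.liminf_le_of_frequently_le h1' hb) (Filter.le_liminf_of_le hc h2')
  · simp only [if_true] at h2
    have h2' : ∀ᶠ i in Filter.atTop, (u i : ℝ) ≤ (x : ℝ) := h2.mono fun i hi => by exact_mod_cast hi
    have h1' : ∃ᶠ i in Filter.atTop, (x : ℝ) ≤ u i := h1.mono fun i hi => by rw [hi]
    have hb : Filter.IsBoundedUnder (· ≤ ·) Filter.atTop (fun i => (u i : ℝ)) := ⟨x, by simpa using h2'⟩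
    have hc : Filter.IsCoboundedUnder (· ≤ ·) Filter.atTop (fun i => (u i : ℝ)) :=
      Filter.IsCoboundedUnder.of_frequently_ge h1'
    exact le_antisymm (Filter.limsup_le_of_le hc h2') (Filter.le_limsup_of_frequently_le h1' hb)

lemma frequently_exists_of_finite {β : Type} [Finite β] {P : ℕ → β → Prop}
    (h : ∃ᶠ i in Filter.atTop, ∃ b, P i b) : ∃ b, ∃ᶠ i in Filter.atTop, P i b := by
  by_contra hno
  push Not at hno
  refine h ?_
  filter_upwards [Filter.eventually_all.2 hno] with i hi
  simpa using hi

/-- Eventually only values that occur infinitely often appear; the least or the greatest of these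
finitely many values is the limit. -/
lemma exists_isVal (sup : Bool) {u : ℕ → ℚ} (hu : (Set.range u).Finite) : ∃ x, IsVal sup u x := by
  set I : Set ℚ := {x | ∃ᶠ i in Filter.atTop, u i = x}
  have hI : I ⊆ Set.range u := fun x hx => by
    obtain ⟨i, hi⟩ := hx.exists
    exact ⟨i, hi⟩
  have hev : ∀ᶠ i in Filter.atTop, u i ∈ I := by
    have : ∀ x ∈ Set.range u \ I, ∀ᶠ i in Filter.atTop, u i ≠ x := fun x hx => by
      simpa [I] using hx.2
    filter_upwards [(Filter.eventually_all_finite (hu.sdiff (t := I))).2 this] with i hi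
    by_contra hno
    exact hi (u i) ⟨⟨i, rfl⟩, hno⟩ rfl
  obtain ⟨i, hi⟩ := hev.exists
  cases sup
  · obtain ⟨x, hx, hmin⟩ := Set.exists_min_image I _root_.id (hu.subset hI) ⟨_, hi⟩
    exact ⟨x, hx, hev.mono fun i hi => by simpa using hmin _ hi⟩
  · obtain ⟨x, hx, hmax⟩ := Set.exists_max_image I _root_.id (hu.subset hI) ⟨_, hi⟩
    exact ⟨x, hx, hev.mono fun i hi => by simpa using hmax _ hi⟩

lemma frequently_add_iff (P : ℕ → Prop) (n : ℕ) :
    (∃ᶠ i in Filter.atTop, P (i + n)) ↔ ∃ᶠ i in Filter.atTop, P i := by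
  rw [Filter.Frequently, Filter.Frequently, not_iff_not]
  exact ⟨fun h => (Filter.eventually_atTop.1 h).elim fun N hN => Filter.eventually_atTop.2
    ⟨N + n, fun i hi => by have := hN (i - n) (by omega); rwa [Nat.sub_add_cancel (by omega)] at this⟩,
    fun h => (Filter.tendsto_add_atTop_nat n).eventually h⟩

lemma isVal_add_iff {sup : Bool} {u : ℕ → ℚ} {x : ℚ} (n : ℕ) :
    IsVal sup (fun i => u (i + n)) x ↔ IsVal sup u x := by
  have h1 := frequently_add_iff (fun i => u i = x) n
  have h2 := frequently_add_iff (fun i => ¬ if sup then u i ≤ x else x ≤ u i) n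
  -- An eventual property is the negation of a frequent one, so the shift lemma for frequent
  -- properties covers it too.
  rw [Filter.Frequently, Filter.Frequently, not_iff_not] at h2
  simp only [not_not] at h2
  exact and_congr h1 h2

lemma IsVal.congr {sup : Bool} {u v : ℕ → ℚ} {x : ℚ} (h : IsVal sup u x)
    (huv : ∀ᶠ i in Filter.atTop, u i = v i) : IsVal sup v x :=
  ⟨(h.1.and_eventually huv).mono fun _ hi => hi.2 ▸ hi.1,
    (h.2.and huv).mono fun _ hi => hi.2 ▸ hi.1⟩

lemma isVal_of_eventually_eq {sup : Bool} {u : ℕ → ℚ} {x : ℚ} (h : ∀ᶠ i in Filter.atTop, u i = x) :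
    IsVal sup u x :=
  ⟨h.frequently, h.mono fun i hi => by split <;> exact (by simp [hi])⟩

/-! ## Runs of deterministic automata -/

section Runs

variable {Λ Q : Type} (nxt : Q → Λ → Q) (wgt : Q → Λ → ℚ)

/-- The states of the run on `w` from `q`. -/
def path (q : Q) (w : Word Λ) : ℕ → Q
  | 0 => q
  | i + 1 => nxt (path q w i) (w i)

/-- The weights of the run on `w` from `q`. -/
def outs (q : Q) (w : Word Λ) (i : ℕ) : ℚ := wgt (path nxt q w i) (w i)

lemma path_add (q : Q) (w : Word Λ) (n i : ℕ) :
    path nxt q w (i + n) = path nxt (path nxt q w n) (fun j => w (j + n)) i := by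
  induction i with
  | zero => simp [path]
  | succ i ih => rw [Nat.add_right_comm, path, ih, path]

lemma outs_add (q : Q) (w : Word Λ) (n : ℕ) :
    (fun i => outs nxt wgt q w (i + n)) =
      outs nxt wgt (path nxt q w n) (fun j => w (j + n)) := by
  funext i
  rw [outs, outs, path_add]

lemma path_extend (q : Q) (w w' : Word Λ) (n : ℕ) :
    path nxt q (extend w n w') n = path nxt q w n := by
  have : ∀ i ≤ n, path nxt q (extend w n w') i = path nxt q w i := by
    intro i
    induction i with
    | zero => intro _; rfl
    | succ i ih =>
      intro hi
      rw [path, path, ih (by omega), extend, if_pos (by omega)]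
  exact this n le_rfl

lemma extend_add (w w' : Word Λ) (n : ℕ) : (fun j => extend w n w' (j + n)) = w' := by
  funext j
  simp [extend]

/-- Prefix independence: a finite prefix matters only through the state to which it leads. -/
lemma isVal_outs_extend {sup : Bool} {q : Q} {w w' : Word Λ} {n : ℕ} {x : ℚ} :
    IsVal sup (outs nxt wgt q (extend w n w')) x ↔ IsVal sup (outs nxt wgt (path nxt q w n) w') x := by
  rw [← isVal_add_iff n, outs_add, extend_add, path_extend]

lemma isVal_outs_path {sup : Bool} {q : Q} {w : Word Λ} {x : ℚ} (n : ℕ) :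
    IsVal sup (outs nxt wgt (path nxt q w n) fun j => w (j + n)) x ↔
      IsVal sup (outs nxt wgt q w) x := by
  rw [← outs_add, isVal_add_iff]

lemma finite_range_outs [Finite Q] [Finite Λ] (q : Q) (w : Word Λ) :
    (Set.range (outs nxt wgt q w)).Finite :=
  (Set.finite_range fun z : Q × Λ => wgt z.1 z.2).subset fun _ ⟨i, hi⟩ =>
    ⟨(path nxt q w i, w i), hi⟩

/-- Determinism leaves exactly one run, so the supremum over runs has a single term. -/
lemma value_eq {A : QAutomaton Λ Q} {nxt : Q → Λ → Q} {wgt : Q → Λ → ℚ}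
    (hA : ∀ q a, A.δ q a = {(wgt q a, nxt q a)}) (Val : (ℕ → ℚ) → ℝ) (w : Word Λ) :
    A.value Val w = (Val (outs nxt wgt A.init w) : EReal) := by
  have hrun : A.IsRun w (path nxt A.init w) (outs nxt wgt A.init w) :=
    ⟨rfl, fun i => by simp [hA, outs, path]⟩
  have huniq : ∀ q x, A.IsRun w q x → x = outs nxt wgt A.init w := by
    intro q x ⟨h0, h⟩
    have hq : ∀ i, q i = path nxt A.init w i := by
      intro i
      induction i with
      | zero => exact h0
      | succ i ih =>
        have := h i
        rw [hA, Finset.mem_singleton, Prod.mk.injEq] at this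
        rw [this.2, ih, path]
    funext i
    have := h i
    rw [hA, Finset.mem_singleton, Prod.mk.injEq] at this
    rw [this.1, hq, outs]
  refine le_antisymm (iSup_le fun q => iSup_le fun x => iSup_le fun h => ?_)
    (le_iSup_of_le _ (le_iSup_of_le _ (le_iSup_of_le hrun le_rfl)))
  rw [huniq q x h]

end Runs

/-! ## The decomposition into a safe and a live part -/

/-- `T q` is the largest value of a word that is read from the state `q`. -/
structure IsBest {Λ Q : Type} (sup : Bool) (nxt : Q → Λ → Q) (wgt : Q → Λ → ℚ) (T : Q → ℚ) : Prop where
  le : ∀ {q w x}, IsVal sup (outs nxt wgt q w) x → x ≤ T q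
  attained : ∀ q, ∃ w, IsVal sup (outs nxt wgt q w) (T q)

section Decomposition

variable {Λ Q : Type} {sup : Bool} {nxt : Q → Λ → Q} {wgt : Q → Λ → ℚ} {T : Q → ℚ}

/-- A best word from the later state, preceded by the prefix read so far, is a competitor at `q`. -/
lemma IsBest.path_le (h : IsBest sup nxt wgt T) (q : Q) (w : Word Λ) (n : ℕ) :
    T (path nxt q w n) ≤ T q := by
  obtain ⟨w', hw'⟩ := h.attained (path nxt q w n)
  exact h.le ((isVal_outs_extend nxt wgt (w := w) (n := n)).2 hw')

lemma IsBest.antitone (h : IsBest sup nxt wgt T) (q : Q) (w : Word Λ) {m n : ℕ} (hmn : m ≤ n) :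
    T (path nxt q w n) ≤ T (path nxt q w m) := by
  obtain ⟨i, rfl⟩ := Nat.exists_eq_add_of_le' hmn
  rw [path_add]
  exact h.path_le _ _ _

lemma IsBest.eventually_const [Finite Q] (h : IsBest sup nxt wgt T) (q : Q) (w : Word Λ) :
    ∃ N, ∀ i, N ≤ i → T (path nxt q w i) = T (path nxt q w N) := by
  obtain ⟨_, ⟨N, rfl⟩, hN⟩ := Set.exists_min_image (Set.range (path nxt q w)) T (Set.toFinite _)
    ⟨_, 0, rfl⟩
  exact ⟨N, fun i hi => le_antisymm (h.antitone q w hi) (hN _ ⟨i, rfl⟩)⟩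

lemma isVal_safe {q : Q} {w : Word Λ} {N : ℕ}
    (hN : ∀ i, N ≤ i → T (path nxt q w i) = T (path nxt q w N)) :
    IsVal sup (outs nxt (fun q a => T (nxt q a)) q w) (T (path nxt q w N)) :=
  isVal_of_eventually_eq (Filter.eventually_atTop.2 ⟨N, fun i hi => hN (i + 1) (by omega)⟩)

/-- The refuting prefix ends where `T` has stabilised: the value of `w` is `T` of the state there,
and no continuation from that state exceeds it, by monotonicity. -/
lemma IsBest.isSafe [Finite Q] (h : IsBest sup nxt wgt T) {B : QAutomaton Λ Q}
    (hB : ∀ q a, B.δ q a = {(T (nxt q a), nxt q a)}) : IsSafe (B.value (limVal sup)) := by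
  intro w v hv
  obtain ⟨N, hN⟩ := h.eventually_const B.init w
  rw [value_eq hB, (isVal_safe hN).limVal_eq] at hv
  refine ⟨N, fun hle => hv (hle.trans (iSup_le fun w' => ?_))⟩
  obtain ⟨M, hM⟩ := h.eventually_const B.init (extend w N w')
  rw [value_eq hB, (isVal_safe hM).limVal_eq]
  have : T (path nxt B.init (extend w N w') M) ≤ T (path nxt B.init w N) := by
    rw [← hM (max M N) (le_max_left _ _), ← path_extend nxt B.init w w' N]
    exact h.antitone _ _ (le_max_right _ _)
  exact_mod_cast this

/-- Beyond `N` the threshold is the constant t = `T (path nxt i w N)`, and `x ≤ t ≤ T i`. If `x <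
t`, occurrences of `x` are kept, and raising weights that are at least t disturbs neither kind of
limit. If `x = t`, then for LimInf eventually every weight is raised, and for LimSup infinitely many
are, while no new weight exceeds `T i`. -/
lemma IsBest.isVal_live (h : IsBest sup nxt wgt T) {i : Q} {w : Word Λ} {N : ℕ} {x : ℚ}
    (hN : ∀ j, N ≤ j → T (path nxt i w j) = T (path nxt i w N))
    (hx : IsVal sup (outs nxt wgt i w) x) :
    IsVal sup (outs nxt (fun q a => if wgt q a < T (nxt q a) then wgt q a else T i) i w)
      (if x < T (path nxt i w N) then x else T i) := by
  have hxt : x ≤ T (path nxt i w N) := h.le ((isVal_outs_path nxt wgt N).2 hx)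
  have htop : T (path nxt i w N) ≤ T i := h.path_le _ _ _
  have hev : ∀ᶠ j in Filter.atTop,
      outs nxt (fun q a => if wgt q a < T (nxt q a) then wgt q a else T i) i w j =
        if outs nxt wgt i w j < T (path nxt i w N) then outs nxt wgt i w j else T i := by
    refine Filter.eventually_atTop.2 ⟨N, fun j hj => ?_⟩
    rw [← hN (j + 1) (by omega)]
    rfl
  refine IsVal.congr ?_ (hev.mono fun _ h => h.symm)
  generalize T (path nxt i w N) = t at *
  obtain ⟨h1, h2⟩ := hx
  split_ifs with hlt
  · cases sup
    · refine ⟨h1.mono fun j hj => by dsimp only; rw [if_pos (by rw [hj]; exact hlt), hj], h2.mono fun j hj => ?_⟩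
      simp only [Bool.false_eq_true, if_false] at hj ⊢
      split <;> linarith
    · refine IsVal.congr ⟨h1, h2⟩ (h2.mono fun j hj => ?_)
      simp only [if_true] at hj
      rw [if_pos (by linarith)]
  · obtain rfl : x = t := le_antisymm hxt (not_lt.1 hlt)
    cases sup
    · refine isVal_of_eventually_eq (h2.mono fun j hj => ?_)
      simp only [Bool.false_eq_true, if_false] at hj
      rw [if_neg (by linarith)]
    · refine ⟨h1.mono fun j hj => by dsimp only; rw [if_neg (by rw [hj]; exact lt_irrefl _)], ?_⟩
      refine Filter.Eventually.of_forall fun j => ?_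
      simp only [if_true]
      split <;> linarith

variable [Finite Q]

lemma IsBest.isLive [Finite Λ] {C : QAutomaton Λ Q} (h : IsBest sup nxt wgt T)
    (hC : ∀ q a, C.δ q a = {(if wgt q a < T (nxt q a) then wgt q a else T C.init, nxt q a)}) :
    IsLive (C.value (limVal sup)) := by
  have hval : ∀ w x N, IsVal sup (outs nxt wgt C.init w) x →
      (∀ j, N ≤ j → T (path nxt C.init w j) = T (path nxt C.init w N)) →
      C.value (limVal sup) w = (((if x < T (path nxt C.init w N) then x else T C.init : ℚ) : ℝ) : EReal) :=
    fun w x N hx hN => by rw [value_eq hC, (h.isVal_live hN hx).limVal_eq]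
  intro w hw
  -- The same hypothesis serves for every word: `T C.init` bounds all values of `C`, so a word below
  -- the top value misses it.
  refine ⟨((T C.init : ℝ) : EReal), fun hle => ?_, fun n => ?_⟩
  · refine absurd (hw.trans_le (iSup_le fun w' => ?_)) (not_lt.2 hle)
    obtain ⟨N, hN⟩ := h.eventually_const C.init w'
    obtain ⟨x, hx⟩ := exists_isVal sup (finite_range_outs nxt wgt C.init w')
    rw [hval w' x N hx hN]
    have : (if x < T (path nxt C.init w' N) then x else T C.init) ≤ T C.init := by
      split
      · exact h.le hx
      · exact le_rfl
    exact_mod_cast this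
  · obtain ⟨w', hw'⟩ := h.attained (path nxt C.init w n)
    obtain ⟨N, hN⟩ := h.eventually_const C.init (extend w n w')
    refine le_iSup_of_le w' (le_of_eq ?_)
    -- The continued word has original value `T (path nxt C.init w n)`. Its eventual best value is
    -- no larger, so the second case of the live value applies.
    rw [hval _ _ N ((isVal_outs_extend nxt wgt).2 hw') hN, if_neg]
    rw [not_lt, ← hN (max N n) (le_max_left _ _), ← path_extend nxt C.init w w' n]
    exact h.antitone _ _ (le_max_right _ _)

lemma IsBest.value_eq_min [Finite Λ] {A B C : QAutomaton Λ Q} (h : IsBest sup nxt wgt T)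
    (hBi : B.init = A.init) (hCi : C.init = A.init)
    (hA : ∀ q a, A.δ q a = {(wgt q a, nxt q a)})
    (hB : ∀ q a, B.δ q a = {(T (nxt q a), nxt q a)})
    (hC : ∀ q a, C.δ q a = {(if wgt q a < T (nxt q a) then wgt q a else T A.init, nxt q a)})
    (w : Word Λ) :
    A.value (limVal sup) w = min (B.value (limVal sup) w) (C.value (limVal sup) w) := by
  obtain ⟨N, hN⟩ := h.eventually_const A.init w
  obtain ⟨x, hx⟩ := exists_isVal sup (finite_range_outs nxt wgt A.init w)
  have hxt : x ≤ T (path nxt A.init w N) := h.le ((isVal_outs_path nxt wgt N).2 hx)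
  have htop : T (path nxt A.init w N) ≤ T A.init := h.path_le _ _ _
  rw [value_eq hA, value_eq hB, value_eq hC, hBi, hCi, hx.limVal_eq, (isVal_safe hN).limVal_eq,
    (h.isVal_live hN hx).limVal_eq]
  split_ifs with hlt
  · exact (min_eq_right (by exact_mod_cast hxt)).symm
  · rw [min_eq_left (by exact_mod_cast htop), le_antisymm hxt (not_lt.1 hlt)]

end Decomposition

/-! ## Correctness of the best values -/

section Best

variable {k n : ℕ} {sup : Bool} {nxt : Fin n → Fin k → Fin n} {wgt : Fin n → Fin k → ℚ}
  {es : List Edge}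

lemma mem_cycleWeights {q : ℕ} {x : ℚ} : x ∈ cycleWeights sup es q ↔
    ∃ p p', (p, x, p') ∈ es ∧ Relation.ReflTransGen (Succ es) q p ∧
      Relation.ReflTransGen (Succ (es.filter fun e => sup || decide (x ≤ e.2.1))) p' p := by
  simp only [cycleWeights, onCycle, List.mem_map, List.mem_filter, Bool.and_eq_true,
    decide_eq_true_eq, mem_reach, Prod.exists]
  constructor
  · rintro ⟨p, y, p', ⟨h1, h2, h3⟩, rfl⟩
    exact ⟨p, p', h1, h3, h2⟩
  · rintro ⟨p, p', h1, h2, h3⟩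
    exact ⟨p, x, p', ⟨h1, h3, h2⟩, rfl⟩

lemma reflTransGen_of_le {r : ℕ → ℕ → Prop} {f : ℕ → ℕ} {i j : ℕ} (hij : i ≤ j)
    (h : ∀ m, i ≤ m → r (f m) (f (m + 1))) : Relation.ReflTransGen r (f i) (f j) := by
  induction hij with
  | refl => exact .refl
  | step hm ih => exact ih.tail (h _ hm)

/-- By pigeonhole the weight `x` is emitted infinitely often from one state `p`. Two such times
beyond the point where the eventual inequality holds enclose a cycle, which for LimInf has no weight
below `x`. -/
lemma mem_cycleWeights_of_isVal (hes : ∀ (q : Fin n) (a : Fin k), ((q : ℕ), wgt q a, (nxt q a : ℕ)) ∈ es) {q : Fin n}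
    {w : Word (Fin k)} {x : ℚ} (h : IsVal sup (outs nxt wgt q w) x) :
    x ∈ cycleWeights sup es q := by
  obtain ⟨h1, h2⟩ := h
  obtain ⟨p, hp⟩ := frequently_exists_of_finite (P := fun i p => outs nxt wgt q w i = x ∧
    path nxt q w i = p) (h1.mono fun i hi => ⟨_, hi, rfl⟩)
  obtain ⟨N, hN⟩ := Filter.eventually_atTop.1 h2
  obtain ⟨i, hi, hix, hip⟩ := Filter.frequently_atTop.1 hp N
  obtain ⟨j, hj, -, hjp⟩ := Filter.frequently_atTop.1 hp (i + 1)
  refine mem_cycleWeights.2 ⟨p, (path nxt q w (i + 1) : Fin n), ?_, ?_, ?_⟩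
  · rw [← hix, ← hip]
    exact hes (path nxt q w i) (w i)
  · rw [← hip]
    exact reflTransGen_of_le (f := fun m => ((path nxt q w m : Fin n) : ℕ)) (Nat.zero_le i)
      fun m _ => ⟨_, hes _ _⟩
  · rw [← hjp]
    refine reflTransGen_of_le (f := fun m => ((path nxt q w m : Fin n) : ℕ)) hj fun m hm =>
      ⟨_, List.mem_filter.2 ⟨hes _ _, ?_⟩⟩
    have := hN m (by omega)
    cases sup
    · simpa [outs] using this
    · rfl

/-- From `q` one can reach `p` in `m` steps through edges that satisfy `S`. -/
def ReachIn (nxt : Fin n → Fin k → Fin n) (S : Fin n → Fin k → Prop) (p : Fin n) : ℕ → Fin n → Prop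
  | 0, q => q = p
  | m + 1, q => ∃ a, S q a ∧ ReachIn nxt S p m (nxt q a)

lemma exists_reachIn {S : Fin n → Fin k → Prop} {r : ℕ → ℕ → Prop}
    (hr : ∀ (q : Fin n) c, r q c → ∃ a, S q a ∧ (nxt q a : ℕ) = c) {p q : Fin n}
    (h : Relation.ReflTransGen r q p) : ∃ m, ReachIn nxt S p m q := by
  have : ∀ m : ℕ, Relation.ReflTransGen r m p → ∀ s : Fin n, (s : ℕ) = m → ∃ l, ReachIn nxt S p l s := by
    intro m hm
    induction hm using Relation.ReflTransGen.head_induction_on with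
    | refl => exact fun s hs => ⟨0, Fin.ext hs⟩
    | head hab _ ih =>
      rintro s rfl
      obtain ⟨a, ha, hc⟩ := hr s _ hab
      obtain ⟨l, hl⟩ := ih _ hc
      exact ⟨l + 1, a, ha, hl⟩
  exact this q h q rfl

/-- A memoryless choice of letters: read `a` at `p`, and elsewhere the first letter of a shortest
path to `p` through `S`. The distance to `p` drops at every step away from `p`, so the run returns
to `p` forever and never leaves `S`. -/
lemma exists_recurrent {S : Fin n → Fin k → Prop} {p : Fin n} {a : Fin k} (hSa : S p a)
    (h : ∃ m, ReachIn nxt S p m (nxt p a)) :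
    ∃ w : Word (Fin k), (∃ᶠ i in Filter.atTop, path nxt p w i = p ∧ w i = a) ∧
      ∀ i, S (path nxt p w i) (w i) := by
  classical
  -- The two conditions on `m` say that the distance from `q` to `p` is `m + 1`. They determine `m`,
  -- so one letter serves for all `m`; without a path the letter is arbitrary.
  have hstep : ∀ q : Fin n, ∃ b, (q = p → b = a) ∧ ∀ m, ReachIn nxt S p (m + 1) q →
      (∀ l < m + 1, ¬ ReachIn nxt S p l q) → S q b ∧ ReachIn nxt S p m (nxt q b) := by
    intro q
    by_cases hq : q = p
    · exact ⟨a, fun _ => rfl, fun m _ hm => absurd hq (hm 0 (by omega))⟩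
    · by_cases hm : ∃ m, ReachIn nxt S p (m + 1) q ∧ ∀ l < m + 1, ¬ ReachIn nxt S p l q
      · obtain ⟨m, ⟨b, hb, hb'⟩, hm⟩ := hm
        refine ⟨b, fun h => absurd h hq, fun m' h1 h2 => ?_⟩
        obtain rfl : m' = m := by
          rcases lt_trichotomy m' m with hlt | heq | hlt
          · exact absurd h1 (hm _ (by omega))
          · exact heq
          · exact absurd ⟨b, hb, hb'⟩ (h2 (m + 1) (by omega))
        exact ⟨hb, hb'⟩
      · exact ⟨a, fun _ => rfl, fun m h1 h2 => absurd ⟨m, h1, h2⟩ hm⟩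
  choose c hca hc using hstep
  set st : ℕ → Fin n := fun i => (fun q => nxt q (c q))^[i] p with hst
  have hss : ∀ i, st (i + 1) = nxt (st i) (c (st i)) := fun i => Function.iterate_succ_apply' _ _ _
  have hpath : ∀ i, path nxt p (fun i => c (st i)) i = st i := by
    intro i
    induction i with
    | zero => rfl
    | succ i ih => rw [path, ih, hss]
  have hnext : ∀ q, (∃ m, ReachIn nxt S p m q) → S q (c q) ∧ ∃ m, ReachIn nxt S p m (nxt q (c q)) := by
    intro q hq
    have h1 := Nat.find_spec hq
    have h2 := fun l => Nat.find_min hq (m := l)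
    revert h1 h2
    cases Nat.find hq with
    | zero =>
      intro h1 _
      obtain rfl : q = p := h1
      rw [hca q rfl]
      exact ⟨hSa, h⟩
    | succ m =>
      intro h1 h2
      obtain ⟨h3, h4⟩ := hc q m h1 fun l hl => h2 l hl
      exact ⟨h3, m, h4⟩
  have hreach : ∀ i, ∃ m, ReachIn nxt S p m (st i) := by
    intro i
    induction i with
    | zero => exact ⟨0, rfl⟩
    | succ i ih => rw [hss]; exact (hnext _ ih).2
  -- If `m` is not the distance to `p`, a smaller value takes its place; if it is, the chosen letter
  -- decreases it.
  have hret : ∀ m i, ReachIn nxt S p m (st i) → ∃ j, i ≤ j ∧ st j = p := by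
    intro m
    induction m using Nat.strong_induction_on with
    | _ m ih =>
      intro i hi
      by_cases hmin : ∃ l < m, ReachIn nxt S p l (st i)
      · obtain ⟨l, hl, hli⟩ := hmin
        exact ih l hl i hli
      · push Not at hmin
        cases m with
        | zero => exact ⟨i, le_rfl, hi⟩
        | succ m =>
          obtain ⟨j, hj, hjp⟩ := ih m (by omega) (i + 1) (by rw [hss]; exact (hc _ m hi hmin).2)
          exact ⟨j, by omega, hjp⟩
  refine ⟨fun i => c (st i), Filter.frequently_atTop.2 fun i => ?_, fun i => ?_⟩
  · obtain ⟨m, hm⟩ := hreach i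
    obtain ⟨j, hj, hjp⟩ := hret m i hm
    exact ⟨j, hj, (hpath j).trans hjp, hca _ hjp⟩
  · rw [hpath]
    exact (hnext _ (hreach i)).1

lemma exists_word_of_reachIn {p : Fin n} {S : Fin n → Fin k → Prop} {y : ℚ} :
    ∀ (m : ℕ) (q : Fin n), ReachIn nxt S p m q →
      (∃ w, IsVal sup (outs nxt wgt p w) y) → ∃ w, IsVal sup (outs nxt wgt q w) y
  | 0, q, h, hw => by obtain rfl : q = p := h; exact hw
  | m + 1, q, ⟨a, _, h⟩, hw => by
    obtain ⟨w, hw⟩ := exists_word_of_reachIn m (nxt q a) h hw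
    exact ⟨extend (fun _ => a) 1 w, (isVal_outs_extend nxt wgt).2 hw⟩

/-- Walk to the cycle and go round it forever. For LimSup the cycle may carry weights above `x`, so
only an inequality is claimed; for the maximal `x` it becomes an equality in `isBest_bestValue`. -/
lemma exists_isVal_of_mem_cycleWeights
    (hes : ∀ e ∈ es, ∀ q : Fin n, e.1 = q → ∃ a, e.2.1 = wgt q a ∧ e.2.2 = nxt q a)
    (hes' : ∀ e ∈ es, e.1 < n) {q : Fin n} {x : ℚ} (h : x ∈ cycleWeights sup es q) :
    ∃ w y, IsVal sup (outs nxt wgt q w) y ∧ x ≤ y := by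
  obtain ⟨p, p', h1, h2, h3⟩ := mem_cycleWeights.1 h
  lift p to Fin n using hes' _ h1
  obtain ⟨a, hax, hap⟩ := hes _ h1 p rfl
  dsimp only at hax hap
  subst hap
  obtain ⟨m, hm⟩ := exists_reachIn (nxt := nxt) (S := fun _ _ => True) (fun s c ⟨y, hy⟩ => by
    obtain ⟨b, -, hb⟩ := hes _ hy s rfl
    exact ⟨b, trivial, hb.symm⟩) h2
  have h4 := exists_reachIn (nxt := nxt) (S := fun s b => sup = true ∨ x ≤ wgt s b)
    (fun s c ⟨y, hy⟩ => by
      obtain ⟨hy, hy'⟩ := List.mem_filter.1 hy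
      obtain ⟨b, hb1, hb⟩ := hes _ hy s rfl
      dsimp only at hb1 hy'
      rw [hb1] at hy'
      exact ⟨b, by simpa using hy', hb.symm⟩) h3
  obtain ⟨w, hw1, hw2⟩ := exists_recurrent (.inr hax.le) h4
  obtain ⟨y, hy⟩ := exists_isVal sup (finite_range_outs nxt wgt p w)
  obtain ⟨w', hw'⟩ := exists_word_of_reachIn m q hm ⟨w, hy⟩
  refine ⟨w', y, hw', ?_⟩
  have hw1 : ∃ᶠ i in Filter.atTop, outs nxt wgt p w i = x :=
    hw1.mono fun i ⟨h1, h2⟩ => by rw [outs, h1, h2, hax]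
  cases sup
  · obtain ⟨i, hi⟩ := hy.1.exists
    have := hw2 i
    simp only [Bool.false_eq_true, false_or] at this
    exact this.trans hi.le
  · obtain ⟨i, hi, hi'⟩ := (hw1.and_eventually hy.2).exists
    simpa [hi] using hi'

lemma isBest_bestValue [Nonempty (Fin k)] (hes : ∀ (q : Fin n) (a : Fin k), ((q : ℕ), wgt q a, (nxt q a : ℕ)) ∈ es)
    (hes₁ : ∀ e ∈ es, ∀ q : Fin n, e.1 = q → ∃ a, e.2.1 = wgt q a ∧ e.2.2 = nxt q a)
    (hes₂ : ∀ e ∈ es, e.1 < n) : IsBest sup nxt wgt (fun q => bestValue sup es q) := by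
  have hle : ∀ {q w x}, IsVal sup (outs nxt wgt q w) x → x ≤ bestValue sup es q :=
    fun {q w x} h => by
      have := mem_cycleWeights_of_isVal hes h
      exact (listMax_spec (List.ne_nil_of_mem this)).2 x this
  refine ⟨hle, fun q => ?_⟩
  -- A letter yields a constant word, hence at least one cycle weight, so `listMax` is a true
  -- maximum and not its default value.
  obtain ⟨a⟩ := ‹Nonempty (Fin k)›
  obtain ⟨x, hx⟩ := exists_isVal sup (finite_range_outs nxt wgt q fun _ => a)
  have hne := List.ne_nil_of_mem (mem_cycleWeights_of_isVal hes hx)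
  obtain ⟨w, y, hy, hxy⟩ := exists_isVal_of_mem_cycleWeights hes₁ hes₂ (listMax_spec hne).1
  have hyx := hle hy
  exact ⟨w, by rwa [show bestValue sup es q = y from le_antisymm hxy hyx]⟩

end Best

/-! ## Automata as inputs and outputs -/

variable {k n : ℕ}

/-- The transition table of an automaton. -/
noncomputable def tableOf (A : QAutomaton (Fin k) (Fin n)) : Table :=
  List.ofFn fun q : Fin n => List.ofFn fun a : Fin k => (A.δ q a).toList.map fun t => (t.1, (t.2 : ℕ))

/-- The automaton `A` with other weights. -/
def reweight (A : QAutomaton (Fin k) (Fin n)) (f : ℚ × ℕ → ℚ) : QAutomaton (Fin k) (Fin n) where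
  init := A.init
  δ q a := (A.δ q a).image fun t => (f (t.1, t.2), t.2)
  total q a := (A.total q a).image _

lemma encode_eq (A : QAutomaton (Fin k) (Fin n)) :
    A.encode = enc ((A.init : ℕ), tableOf A) := by
  simp only [QAutomaton.encode, tableOf, enc, List.map_ofFn, Function.comp_def, List.map_map]

variable {A : QAutomaton (Fin k) (Fin n)} {nxt : Fin n → Fin k → Fin n} {wgt : Fin n → Fin k → ℚ}

lemma reweight_δ (hA : ∀ q a, A.δ q a = {(wgt q a, nxt q a)}) (f : ℚ × ℕ → ℚ) (q : Fin n) (a : Fin k) :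
    (reweight A f).δ q a = {(f (wgt q a, nxt q a), nxt q a)} := by
  simp [reweight, hA]

lemma tableOf_eq (hA : ∀ q a, A.δ q a = {(wgt q a, nxt q a)}) :
    tableOf A = List.ofFn fun q => List.ofFn fun a => [(wgt q a, (nxt q a : ℕ))] := by
  simp [tableOf, hA]

lemma tableOf_reweight (hA : ∀ q a, A.δ q a = {(wgt q a, nxt q a)}) (f : ℚ × ℕ → ℚ) :
    tableOf (reweight A f) = mapTable f (tableOf A) := by
  rw [tableOf_eq hA, tableOf_eq (reweight_δ hA f)]
  simp [mapTable, List.map_ofFn, Function.comp_def]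

lemma mem_tableEdges_tableOf (hA : ∀ q a, A.δ q a = {(wgt q a, nxt q a)}) {e : Edge} :
    e ∈ tableEdges (tableOf A) ↔ ∃ (q : Fin n) (a : Fin k), e = ((q : ℕ), wgt q a, (nxt q a : ℕ)) := by
  rw [mem_tableEdges, tableOf_eq hA]
  obtain ⟨p, c⟩ := e
  constructor
  · rintro ⟨row, cell, h1, h2, h3⟩
    obtain ⟨hp, h1⟩ := List.getElem?_eq_some_iff.1 h1
    simp only [List.getElem_ofFn] at h1
    subst h1
    obtain ⟨a, rfl⟩ := List.mem_ofFn.1 h2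
    exact ⟨⟨p, by simpa using hp⟩, a, Prod.ext rfl (List.mem_singleton.1 h3)⟩
  · rintro ⟨q, a, h⟩
    simp only [Prod.mk.injEq] at h
    obtain ⟨rfl, rfl⟩ := h
    exact ⟨List.ofFn fun a => [(wgt q a, (nxt q a : ℕ))], _, by simp, List.mem_ofFn.2 ⟨a, rfl⟩, List.mem_singleton.2 rfl⟩

lemma sz_rat_le (x : ℚ) : sz x ≤ 4 * ratBits x + 7 := by
  have h1 : sz x = 1 + sz (decide (x < 0)) + (1 + sz x.num.natAbs.bits + sz x.den.bits) := rfl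
  have h2 := sz_bool_le (decide (x < 0))
  have h3 := sz_bits_le x.num.natAbs.bits
  have h4 := sz_bits_le x.den.bits
  rw [Nat.size_eq_bits_len] at h3 h4
  rw [h1, ratBits]
  omega

lemma ratBits_le_size (hA : ∀ q a, A.δ q a = {(wgt q a, nxt q a)}) (q : Fin n) (a : Fin k) :
    ratBits (wgt q a) ≤ A.size := by
  have h1 : (∑ a, ∑ t ∈ A.δ q a, (1 + ratBits t.1)) ≤ ∑ q, ∑ a, ∑ t ∈ A.δ q a, (1 + ratBits t.1) :=
    Finset.single_le_sum (f := fun q => ∑ a, ∑ t ∈ A.δ q a, (1 + ratBits t.1))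
      (fun _ _ => Nat.zero_le _) (Finset.mem_univ q)
  have h2 : (∑ t ∈ A.δ q a, (1 + ratBits t.1)) ≤ ∑ a, ∑ t ∈ A.δ q a, (1 + ratBits t.1) :=
    Finset.single_le_sum (f := fun a => ∑ t ∈ A.δ q a, (1 + ratBits t.1))
      (fun _ _ => Nat.zero_le _) (Finset.mem_univ a)
  rw [hA, Finset.sum_singleton] at h2
  have h3 := (le_max_right n _).trans (le_max_right k (max n (∑ q, ∑ a, ∑ t ∈ A.δ q a, (1 + ratBits t.1))))
  rw [QAutomaton.size]
  dsimp only at h2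
  omega

/-- The running time is polynomial in the size of the input tree, and this converts it into the size
of the automaton. Unary state names do no harm, since `n` is at most that size. -/
lemma sz_input_le (hA : ∀ q a, A.δ q a = {(wgt q a, nxt q a)}) :
    sz ((A.init : ℕ), tableOf A) ≤
      A.size * (A.size * (6 * A.size + 12) + 2) + 1 + (2 * A.size + 2) := by
  have hk : k ≤ A.size := le_max_left _ _
  have hn : n ≤ A.size := (le_max_left _ _).trans (le_max_right _ _)
  have hi := A.init.2
  have hcell : ∀ q a, sz [(wgt q a, (nxt q a : ℕ))] ≤ 6 * A.size + 11 := fun q a => by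
    have h1 := sz_rat_le (wgt q a)
    have h2 := ratBits_le_size hA q a
    have h3 := (nxt q a).2
    rw [sz_cons, sz_pair, sz_nil, sz_nat]
    omega
  have hrow : ∀ q, sz (List.ofFn fun a => [(wgt q a, (nxt q a : ℕ))]) ≤
      A.size * (6 * A.size + 12) + 1 := fun q => by
    refine (sz_list_le (M := 6 * A.size + 11) fun c hc => ?_).trans ?_
    · obtain ⟨a, rfl⟩ := List.mem_ofFn.1 hc
      exact hcell q a
    · rw [List.length_ofFn, add_comm 1]
      exact Nat.succ_le_succ (Nat.mul_le_mul_right _ hk)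
  have htable : sz (tableOf A) ≤ A.size * (A.size * (6 * A.size + 12) + 2) + 1 := by
    rw [tableOf_eq hA]
    refine (sz_list_le (M := A.size * (6 * A.size + 12) + 1) fun c hc => ?_).trans ?_
    · obtain ⟨q, rfl⟩ := List.mem_ofFn.1 hc
      exact hrow q
    · rw [List.length_ofFn, add_comm 1]
      exact Nat.succ_le_succ (Nat.mul_le_mul_right _ hn)
  rw [sz_pair, sz_nat]
  omega

end QAut

/-! ### The main theorem. -/

theorem mainTheorem7 (Val : (ℕ → ℚ) → ℝ)
    (hVal : Val = QAut.limInfVal ∨ Val = QAut.limSupVal) :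
    ∃ (p : QAut.Program) (P : Polynomial ℕ),
      ∀ (k n : ℕ) (A : QAut.QAutomaton (Fin k) (Fin n)), A.IsDeterministic →
        ∃ (n₁ n₂ : ℕ) (B : QAut.QAutomaton (Fin k) (Fin n₁))
          (C : QAut.QAutomaton (Fin k) (Fin n₂)),
          p.OutputsInTime A.encode (QAut.Data.cons B.encode C.encode) (P.eval A.size) ∧
          B.IsDeterministic ∧ QAut.IsSafe (B.value Val) ∧
          C.IsDeterministic ∧ QAut.IsLive (C.value Val) ∧
          ∀ w : QAut.Word (Fin k), A.value Val w = min (B.value Val w) (C.value Val w) := by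
  obtain ⟨sup, rfl⟩ : ∃ sup, Val = QAut.limVal sup := by
    rcases hVal with rfl | rfl
    · exact ⟨false, rfl⟩
    · exact ⟨true, rfl⟩
  obtain ⟨p, N, T, ⟨P, hP⟩, hp, -⟩ := QAut.PolyTime.decompose sup
  -- The inner polynomial is the bound of `sz_input_le` on the size of the input tree.
  refine ⟨p, P.comp (.X * (.X * (6 * .X + 12) + 2) + 1 + (2 * .X + 2)), fun k n A hdet => ?_⟩
  choose t ht using hdet
  obtain ⟨wgt, nxt, hA⟩ : ∃ (wgt : Fin n → Fin k → ℚ) (nxt : Fin n → Fin k → Fin n),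
      ∀ q a, A.δ q a = {(wgt q a, nxt q a)} := ⟨fun q a => (t q a).1, fun q a => (t q a).2, ht⟩
  set es := QAut.tableEdges (QAut.tableOf A) with hes
  have hB := QAut.reweight_δ hA (QAut.safeWeight sup es)
  have hC := QAut.reweight_δ hA (QAut.liveWeight sup es A.init)
  -- Best values need a nonempty alphabet. Safety, liveness and the equation all begin with a word,
  -- which supplies a letter; over the empty alphabet they hold vacuously.
  have hbest (w : QAut.Word (Fin k)) :
      QAut.IsBest sup nxt wgt (fun q => QAut.bestValue sup es q) := by
    have : Nonempty (Fin k) := ⟨w 0⟩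
    refine QAut.isBest_bestValue (fun q a => (QAut.mem_tableEdges_tableOf hA).2 ⟨q, a, rfl⟩) ?_ ?_
    · intro e he q hq
      obtain ⟨q', a, rfl⟩ := (QAut.mem_tableEdges_tableOf hA).1 he
      obtain rfl : q' = q := Fin.ext hq
      exact ⟨a, rfl, rfl⟩
    · intro e he
      obtain ⟨q, a, rfl⟩ := (QAut.mem_tableEdges_tableOf hA).1 he
      exact q.2
  have hC' : ∀ q a, (QAut.reweight A (QAut.liveWeight sup es A.init)).δ q a =
      {(if wgt q a < QAut.bestValue sup es (nxt q a) then wgt q a else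
        QAut.bestValue sup es A.init, nxt q a)} := fun q a => by
    rw [hC, QAut.liveWeight]
    simp only [decide_eq_true_eq]
  refine ⟨n, n, QAut.reweight A (QAut.safeWeight sup es),
    QAut.reweight A (QAut.liveWeight sup es A.init), ?_, fun q a => ⟨_, hB q a⟩,
    fun w => (hbest w).isSafe hB w, fun q a => ⟨_, hC q a⟩, fun w => (hbest w).isLive hC' w,
    fun w => (hbest w).value_eq_min (A := A) (B := QAut.reweight A _) (C := QAut.reweight A _) rfl rfl hA hB hC' w⟩
  obtain ⟨u, s, h1, h2, h3, -⟩ := hp ((A.init : ℕ), QAut.tableOf A)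
    (QAut.Store.initial A.encode) (QAut.encode_eq A)
  refine ⟨u, s, h2.trans ((hP _).trans ?_), h1, ?_⟩
  · rw [Polynomial.eval_comp]
    exact QAut.eval_mono P ((QAut.sz_input_le hA).trans (by simp))
  · rw [h3, QAut.encode_eq, QAut.encode_eq, QAut.tableOf_reweight hA, QAut.tableOf_reweight hA]
    rfl
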